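/- Let $L$ be an even lattice of signature $(p,q)$ with $p\le q$, put $\sigma(L)=p-q$, and let $I\subset L$ be a primitive isotropic sublattice of rank $p$. Let $A_L=L^\vee/L$ be the discriminant group with $q_L(\lambda)=(\lambda,\lambda)/2\in\mathbb{Q}/\mathbb{Z}$, and write $e(x)=\exp(2\pi i x)$. Let $\rho_L$ be the Weil representation of $\mathrm{Mp}_2(\mathbb{Z})$ on $\mathbb{C}A_L$, determined by $$\rho_L(T)\mathbf{e}_\lambda=e(q_L(\lambda))\mathbf{e}_\lambda,\qquad \rho_L(S)\mathbf{e}_\lambda=\frac{e(-\sigma(L)/8)}{\sqrt{|A_L|}}\sum_{\mu\in A_L}e(-(\lambda,\mu))\mathbf{e}_\mu ,$$ where $T=\left(\begin{pmatrix}1&1\\0&1\end{pmatrix},1\right)$ and $S=\left(\begin{pmatrix}0&-1\\1&0\end{pmatrix},\sqrt{\tau}\right)$. Let $M^!(L)$ be the space of weakly holomorphic modular forms of weight $\sigma(L)/2$ and type $\rho_L$, that is, of holomorphic functions $f$ from the upper half plane to $\mathbb{C}A_L$ with $f(M\tau)=\phi(\tau)^{\sigma(L)}\rho_L(M,\phi)f(\tau)$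 for all $(M,\phi)\in\mathrm{Mp}_2(\mathbb{Z})$ which are meromorphic at the cusp. They have Fourier expansions $f=\sum_{\lambda\in A_L}\sum_{n\in q_L(\lambda)+\mathbb{Z}}c_\lambda(n)q^n\mathbf{e}_\lambda$ with finitely many nonzero $c_\lambda(n)$ for $n<0$. Let $I^*=I_{\mathbb{Q}}\cap L^\vee$, let $L^*=L+I^*$ (an even overlattice of $L$), and let $K=(I^\perp\cap L)/I$, a negative definite even lattice; let $K^+=K(-1)$. There is a canonical isometry $A_{L^*}\cong A_K$, sending the class of $y\in (L^*)^\vee\cap I_{\mathbb{Q}}^\perp$ to the class of $y$ modulo $I_{\mathbb{Q}}$. Let $\downarrow^L_K\colon\mathbb{C}A_L\to\mathbb{C}A_{L^*}=\mathbb{C}A_K$ be the linear map which sends $\mathbf{e}_\mu$ to $\mathbf{e}_{p(\mu)}$ if $\mu\in (L^*)^\vee/L$, where $p\colon(L^*)^\vee/L\to A_{L^*}$ is the projection, and to $0$ otherwise. Let $\Theta_{K^+}(\tau)=\sum_{l\in (K^+)^\vee}q^{(l,l)/2}\mathbf{e}_{[l]}$, with values in $\mathbb{C}A_{K^+}=(\mathbb{C}A_K)^\vee$.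 For $f_1,f_2\in M^!(L)$ the $\Theta$-product with respect to $I$ is $$f_1\ast f_2=\langle f_1{\downarrow^L_K},\Theta_{K^+}\rangle\cdot f_2 .$$ Then $M^!(L)$, with pointwise addition and $\ast$, is an associative ring (not necessarily commutative or with a unit element), and the group $M^!(L)'_{\mathbb{Z}}$ of those $f\in M^!(L)$ all of whose Fourier coefficients $c_\lambda(n)$ are integers is closed under $\ast$. Hence $M^!(L)'_{\mathbb{Z}}$ is a subring of $M^!(L)$. -/

import Mathlib

open scoped UpperHalfPlane MatrixGroups Manifold

namespace ThetaProduct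

noncomputable section

/-- The function `e(x) = exp(2πix)`. -/
def e (x : ℂ) : ℂ := Complex.exp (2 * (Real.pi : ℂ) * Complex.I * x)

/-! ### The metaplectic group -/

/-- The metaplectic double cover `Mp₂(ℤ)` of `SL₂(ℤ)`: pairs `(M, φ)` with
`M = (a b; c d) ∈ SL₂(ℤ)` and `φ` holomorphic on the upper half plane, `φ(τ)² = cτ + d`. -/
@[ext]
structure Mp2Z where
  mat : SL(2, ℤ)
  phi : ℍ → ℂ
  holo : MDiff phi
  sq : ∀ τ : ℍ, phi τ ^ 2 = UpperHalfPlane.denom mat τ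

namespace Mp2Z

lemma phi_ne_zero (g : Mp2Z) (τ : ℍ) : g.phi τ ≠ 0 := by
  intro h
  have h1 := g.sq τ
  rw [h, zero_pow two_ne_zero] at h1
  exact UpperHalfPlane.denom_ne_zero _ _ h1.symm

lemma denom_mul (M N : SL(2, ℤ)) (τ : ℍ) :
    UpperHalfPlane.denom (M * N : SL(2, ℤ)) τ =
      UpperHalfPlane.denom M ((N • τ : ℍ) : ℂ) * UpperHalfPlane.denom N τ := by
  have h := UpperHalfPlane.denom_cocycle_σ (M : GL (Fin 2) ℝ) (N : GL (Fin 2) ℝ) τ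
  have hσ : UpperHalfPlane.σ (N : GL (Fin 2) ℝ) = ContinuousAlgEquiv.refl ℝ ℂ := by
    simp [UpperHalfPlane.σ]
  rw [hσ] at h
  rw [map_mul, map_mul]
  exact h

lemma mdiff_smul (M : SL(2, ℤ)) : MDiff (fun τ : ℍ => M • τ) := by
  have h : (0 : ℝ) < ((M : GL (Fin 2) ℝ)).det.val := by simp
  exact UpperHalfPlane.mdifferentiable_smul h

/-- `(M, φ(τ)) (N, ψ(τ)) = (MN, φ(Nτ)ψ(τ))`. -/
instance : Mul Mp2Z where
  mul g h :=
    { mat := g.mat * h.mat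
      phi := fun τ => g.phi (h.mat • τ) * h.phi τ
      holo := (g.holo.comp (mdiff_smul h.mat)).mul h.holo
      sq := fun τ => by rw [mul_pow, g.sq, h.sq, denom_mul] }

instance : One Mp2Z where
  one :=
    { mat := 1
      phi := fun _ => 1
      holo := mdifferentiable_const
      sq := fun τ => by simp [UpperHalfPlane.denom_one] }

instance : Inv Mp2Z where
  inv g :=
    { mat := g.mat⁻¹
      phi := fun τ => (g.phi (g.mat⁻¹ • τ))⁻¹
      holo := by
        have h := g.holo.comp (mdiff_smul g.mat⁻¹)
        rw [UpperHalfPlane.mdifferentiable_iff] at h ⊢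
        exact h.inv (fun z _ => g.phi_ne_zero _)
      sq := fun τ => by
        rw [inv_pow, g.sq]
        have h := denom_mul g.mat g.mat⁻¹ τ
        rw [mul_inv_cancel] at h
        have h1 : UpperHalfPlane.denom ((1 : SL(2, ℤ)) : GL (Fin 2) ℝ) (τ : ℂ) = 1 := by
          simp [UpperHalfPlane.denom_one]
        rw [h1] at h
        exact inv_eq_of_mul_eq_one_right h.symm }

@[simp] lemma mul_mat (g h : Mp2Z) : (g * h).mat = g.mat * h.mat := rfl
@[simp] lemma mul_phi (g h : Mp2Z) (τ : ℍ) :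
    (g * h).phi τ = g.phi (h.mat • τ) * h.phi τ := rfl
@[simp] lemma one_mat : (1 : Mp2Z).mat = 1 := rfl
@[simp] lemma one_phi (τ : ℍ) : (1 : Mp2Z).phi τ = 1 := rfl
@[simp] lemma inv_mat (g : Mp2Z) : (g⁻¹).mat = g.mat⁻¹ := rfl
@[simp] lemma inv_phi (g : Mp2Z) (τ : ℍ) :
    (g⁻¹).phi τ = (g.phi (g.mat⁻¹ • τ))⁻¹ := rfl

instance : Group Mp2Z where
  mul_assoc a b c := by
    refine Mp2Z.ext (mul_assoc _ _ _) (funext fun τ => ?_)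
    simp only [mul_phi, mul_mat, mul_smul, mul_assoc]
  one_mul a := by
    refine Mp2Z.ext (one_mul _) (funext fun τ => ?_)
    simp only [mul_phi, one_phi, one_mul]
  mul_one a := by
    refine Mp2Z.ext (mul_one _) (funext fun τ => ?_)
    simp only [mul_phi, one_phi, one_mat, one_smul, mul_one]
  inv_mul_cancel a := by
    refine Mp2Z.ext (inv_mul_cancel _) (funext fun τ => ?_)
    simp only [mul_phi, inv_phi, one_phi, inv_smul_smul]
    exact inv_mul_cancel₀ (a.phi_ne_zero τ)

/-- `T = ((1 1; 0 1), 1)`. -/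
def T : Mp2Z where
  mat := ModularGroup.T
  phi := fun _ => 1
  holo := mdifferentiable_const
  sq := fun τ => by rw [ModularGroup.denom_apply]; simp [ModularGroup.T]

/-- `S = ((0 -1; 1 0), √τ)`, with the principal branch of the square root. -/
def S : Mp2Z where
  mat := ModularGroup.S
  phi := fun τ => (τ : ℂ) ^ (1 / 2 : ℂ)
  holo := by
    rw [UpperHalfPlane.mdifferentiable_iff]
    have h : DifferentiableOn ℂ (fun z : ℂ => z ^ (1 / 2 : ℂ)) {z | 0 < z.im} := fun z hz =>
      (differentiableAt_id.cpow_const (Or.inr (ne_of_gt hz))).differentiableWithinAt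
    exact h.congr fun z hz => by simp [UpperHalfPlane.ofComplex_apply_of_im_pos hz]
  sq := fun τ => by
    rw [ModularGroup.denom_S, ← Complex.cpow_nat_mul]
    norm_num

end Mp2Z

/-! ### Lattices, discriminant groups and the Weil representation -/

section Basic

variable {V : Type*} [AddCommGroup V] [Module ℚ V]

/-- The discriminant group `A_N = N^∨ / N`, where `N^∨ = {x | (x, N) ⊆ ℤ}`. -/
abbrev Disc (B : LinearMap.BilinForm ℚ V) (N : Submodule ℤ V) : Type _ :=
  ↥(B.dualSubmodule N) ⧸ N.submoduleOf (B.dualSubmodule N)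

/-- A vector of `N^∨` that represents a given class of `A_N`. -/
def rep {B : LinearMap.BilinForm ℚ V} {N : Submodule ℤ V} (a : Disc B N) : V :=
  (Quotient.out a : ↥(B.dualSubmodule N))

/-- The class in `A_N` of a vector of `N^∨`. -/
def cls (B : LinearMap.BilinForm ℚ V) (N : Submodule ℤ V) (x : V)
    (hx : x ∈ B.dualSubmodule N) : Disc B N :=
  Submodule.Quotient.mk ⟨x, hx⟩

/-- The operator `ρ_N(T)` on the group ring `ℂA_N`: `e_λ ↦ e(q(λ)) e_λ`, where
`q(λ) = (λ, λ)/2 ∈ ℚ/ℤ`. -/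
def weilT (B : LinearMap.BilinForm ℚ V) (N : Submodule ℤ V) :
    Module.End ℂ (Disc B N →₀ ℂ) :=
  Finsupp.linearCombination ℂ fun a =>
    e ((B (rep a) (rep a) / 2 : ℚ) : ℂ) • Finsupp.single a (1 : ℂ)

/-- The operator `ρ_N(S)` on `ℂA_N`:
`e_λ ↦ e(-σ/8) |A_N|^{-1/2} ∑_μ e(-(λ, μ)) e_μ`, where `σ` is the signature of `N`. -/
def weilS (B : LinearMap.BilinForm ℚ V) (N : Submodule ℤ V) (σ : ℤ) :
    Module.End ℂ (Disc B N →₀ ℂ) :=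
  Finsupp.linearCombination ℂ fun a =>
    (e (-(σ : ℂ) / 8) / (Real.sqrt (Nat.card (Disc B N)) : ℂ)) •
      ∑ᶠ b : Disc B N, e (-((B (rep a) (rep b) : ℚ) : ℂ)) • Finsupp.single b (1 : ℂ)

/-- The graph `{(g, ρ_N(g))}` of the Weil representation of `Mp₂(ℤ)` on `ℂA_N`, i.e. of the
multiplicative extension of `T ↦ ρ_N(T)`, `S ↦ ρ_N(S)`. (`S` and `T` generate `Mp₂(ℤ)` even as
a monoid, because `S` and `ST` have finite order.) -/
def weilGraph (B : LinearMap.BilinForm ℚ V) (N : Submodule ℤ V) (σ : ℤ) :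
    Submonoid (Mp2Z × Module.End ℂ (Disc B N →₀ ℂ)) :=
  Submonoid.closure {(Mp2Z.T, weilT B N), (Mp2Z.S, weilS B N σ)}

/-- `f = ∑_λ ∑_{n ∈ q(λ) + ℤ} c_λ(n) q^n e_λ` on the upper half plane, with only finitely many
nonzero coefficients for negative `n`. -/
structure HasFourierExpansion (B : LinearMap.BilinForm ℚ V) (N : Submodule ℤ V)
    (f : ℍ → (Disc B N →₀ ℂ)) (c : Disc B N → ℚ → ℂ) : Prop where
  support : ∀ a n, c a n ≠ 0 → ∃ m : ℤ, n = B (rep a) (rep a) / 2 + m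
  bddBelow : ∃ n₀ : ℚ, ∀ a n, n < n₀ → c a n = 0
  hasSum : ∀ a (τ : ℍ), HasSum (fun n : ℚ => c a n * e ((n : ℂ) * (τ : ℂ))) (f τ a)

/-- `f` is a weakly holomorphic modular form of weight `k = w/2` and type `ρ_N`, where `σ` is the
signature of `N`: it is holomorphic, `f(Mτ) = φ(τ)^{2k} ρ_N(M, φ) f(τ)` for all
`(M, φ) ∈ Mp₂(ℤ)`, and it is meromorphic at the cusp. -/
structure IsWeaklyHolomorphicModularForm (B : LinearMap.BilinForm ℚ V) (N : Submodule ℤ V)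
    (σ w : ℤ) (f : ℍ → (Disc B N →₀ ℂ)) : Prop where
  holo : ∀ a, MDiff (fun τ : ℍ => f τ a)
  modular : ∀ (g : Mp2Z) (ρg : Module.End ℂ (Disc B N →₀ ℂ)), (g, ρg) ∈ weilGraph B N σ →
    ∀ τ : ℍ, f (g.mat • τ) = (g.phi τ ^ w) • ρg (f τ)
  meromorphic : ∃ c, HasFourierExpansion B N f c

/-- The coset theta series `∑_{l ∈ λ + N} q^{(l, l)/2}`, i.e. the `λ`-component of the theta
series `Θ_N` of a positive definite lattice `N`. -/
def theta (B : LinearMap.BilinForm ℚ V) (N : Submodule ℤ V) (τ : ℍ) (a : Disc B N) : ℂ :=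
  ∑' l : {l : ↥(B.dualSubmodule N) // (Submodule.Quotient.mk l : Disc B N) = a},
    e (((B l.1 l.1 / 2 : ℚ) : ℂ) * (τ : ℂ))

open Classical in
/-- The pushforward `↓ : ℂA_N → ℂA_{N'}` for an overlattice `N ⊆ N' ⊆ N^∨`. With `J = N'/N`, so
`J^⊥ = N'^∨/N ⊆ A_N`, it maps `e_μ` to `e_{p(μ)}` for `μ ∈ J^⊥`, with `p : J^⊥ → A_{N'}` the
projection, and to `0` for `μ ∉ J^⊥`. -/
def pushforward (B : LinearMap.BilinForm ℚ V) (N N' : Submodule ℤ V) :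
    (Disc B N →₀ ℂ) →ₗ[ℂ] (Disc B N' →₀ ℂ) :=
  Finsupp.linearCombination ℂ fun a =>
    if h : rep a ∈ B.dualSubmodule N' then Finsupp.single (cls B N' (rep a) h) 1 else 0

lemma dualSubmodule_le_neg (B : LinearMap.BilinForm ℚ V) (N : Submodule ℤ V) :
    B.dualSubmodule N ≤ (-B).dualSubmodule N := fun x hx y hy => by
  simpa using neg_mem (hx y hy)

/-- The identification of abelian groups `A_N = A_{N(-1)}`. -/
def discNeg (B : LinearMap.BilinForm ℚ V) (N : Submodule ℤ V) :
    Disc B N →ₗ[ℤ] Disc (-B) N :=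
  Submodule.mapQ _ _ (Submodule.inclusion (dualSubmodule_le_neg B N)) fun _ hx => hx

end Basic

/-- An even lattice, as a full lattice in the rational quadratic space `V = L_ℚ`. -/
structure EvenLattice (V : Type*) [AddCommGroup V] [Module ℚ V] where
  form : LinearMap.BilinForm ℚ V
  lat : Submodule ℤ V
  symm : form.IsSymm
  nondegenerate : form.Nondegenerate
  fg : lat.FG
  span_eq_top : Submodule.span ℚ (lat : Set V) = ⊤
  integral : ∀ x ∈ lat, ∀ y ∈ lat, ∃ m : ℤ, form x y = m
  even : ∀ x ∈ lat, ∃ m : ℤ, form x x = 2 * m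

namespace EvenLattice

variable {V : Type*} [AddCommGroup V] [Module ℚ V] (L : EvenLattice V)

/-- `p` for a lattice of signature `(p, q)`. -/
def sigPos : ℕ := _root_.sigPos L.form.toQuadraticMap

/-- `q` for a lattice of signature `(p, q)`. -/
def sigNeg : ℕ := _root_.sigNeg L.form.toQuadraticMap

/-- `σ(L) = p - q`. -/
def sigma : ℤ := (L.sigPos : ℤ) - L.sigNeg

/-- The discriminant group `A_L = L^∨/L`. -/
abbrev A : Type _ := Disc L.form L.lat

/-- The space `M^!(L)` of weakly holomorphic modular forms of weight `σ(L)/2` and type `ρ_L`. -/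
def forms : Submodule ℂ (ℍ → (L.A →₀ ℂ)) where
  carrier := {f | IsWeaklyHolomorphicModularForm L.form L.lat L.sigma L.sigma f}
  zero_mem' :=
    { holo := fun a => mdifferentiable_const
      modular := fun g ρg _ τ => by simp
      meromorphic := ⟨0, by simp, ⟨0, by simp⟩, fun a τ => by simp⟩ }
  add_mem' := by
    rintro f g ⟨hf, hf', cf, hcf⟩ ⟨hg, hg', cg, hcg⟩
    refine ⟨fun a => (hf a).add (hg a), fun x ρx hx τ => ?_, cf + cg, ?_, ?_, ?_⟩
    · simp only [Pi.add_apply, hf' x ρx hx, hg' x ρx hx, map_add, smul_add]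
    · intro a n h
      by_cases h1 : cf a n = 0
      · exact hcg.support a n (by simpa [h1] using h)
      · exact hcf.support a n h1
    · obtain ⟨n₁, h₁⟩ := hcf.bddBelow
      obtain ⟨n₂, h₂⟩ := hcg.bddBelow
      exact ⟨min n₁ n₂, fun a n hn => by
        simp [h₁ a n (hn.trans_le (min_le_left _ _)), h₂ a n (hn.trans_le (min_le_right _ _))]⟩
    · intro a τ
      simpa [add_mul] using (hcf.hasSum a τ).add (hcg.hasSum a τ)
  smul_mem' := by
    rintro r f ⟨hf, hf', cf, hcf⟩
    refine ⟨fun a => ?_, fun x ρx hx τ => ?_, fun a n => r * cf a n, ?_, ?_, ?_⟩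
    · exact (mdifferentiable_const (c := r)).mul (hf a)
    · simp only [Pi.smul_apply, hf' x ρx hx, map_smul]
      exact smul_comm _ _ _
    · intro a n h
      exact hcf.support a n (right_ne_zero_of_mul h)
    · obtain ⟨n₁, h₁⟩ := hcf.bddBelow
      exact ⟨n₁, fun a n hn => by simp [h₁ a n hn]⟩
    · intro a τ
      simpa [mul_assoc] using (hcf.hasSum a τ).mul_left r

/-- The group `M^!(L)'_ℤ` of those `f ∈ M^!(L)` all of whose Fourier coefficients are integers. -/
def integralForms : AddSubgroup (ℍ → (L.A →₀ ℂ)) where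
  carrier := {f | f ∈ L.forms ∧
    ∃ c : L.A → ℚ → ℤ, HasFourierExpansion L.form L.lat f fun a n => (c a n : ℂ)}
  zero_mem' := ⟨zero_mem _, 0, by simp, ⟨0, by simp⟩, fun a τ => by simp⟩
  add_mem' := by
    rintro f g ⟨hf, cf, hcf⟩ ⟨hg, cg, hcg⟩
    refine ⟨add_mem hf hg, cf + cg, ?_, ?_, ?_⟩
    · intro a n h
      by_cases h1 : cf a n = 0
      · exact hcg.support a n (by simpa [h1] using h)
      · exact hcf.support a n (by exact_mod_cast h1)
    · obtain ⟨n₁, h₁⟩ := hcf.bddBelow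
      obtain ⟨n₂, h₂⟩ := hcg.bddBelow
      refine ⟨min n₁ n₂, fun a n hn => ?_⟩
      have e₁ := h₁ a n (hn.trans_le (min_le_left _ _))
      have e₂ := h₂ a n (hn.trans_le (min_le_right _ _))
      simp only [Pi.add_apply, Int.cast_add, e₁, e₂, add_zero]
    · intro a τ
      simpa [add_mul] using (hcf.hasSum a τ).add (hcg.hasSum a τ)
  neg_mem' := by
    rintro f ⟨hf, cf, hcf⟩
    refine ⟨neg_mem hf, -cf, ?_, ?_, ?_⟩
    · intro a n h
      exact hcf.support a n (by simpa using h)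
    · obtain ⟨n₁, h₁⟩ := hcf.bddBelow
      exact ⟨n₁, fun a n hn => by simpa using h₁ a n hn⟩
    · intro a τ
      simpa using (hcf.hasSum a τ).neg

/-- The value `e(q(λ))` does not depend on the representative of `λ`. -/
lemma e_quad_rep (x : V) (hx : x ∈ L.form.dualSubmodule L.lat) :
    e ((L.form (rep (cls L.form L.lat x hx)) (rep (cls L.form L.lat x hx)) / 2 : ℚ) : ℂ) =
      e ((L.form x x / 2 : ℚ) : ℂ) := by
  set y := rep (cls L.form L.lat x hx) with hy
  have hyx : y - x ∈ L.lat := by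
    have h := (Submodule.Quotient.eq (L.lat.submoduleOf (L.form.dualSubmodule L.lat))).1
      (Quotient.out_eq (cls L.form L.lat x hx))
    exact h
  obtain ⟨m, hm⟩ := L.even _ hyx
  obtain ⟨k, hk⟩ := Submodule.mem_one.1 (hx _ hyx)
  have hk' : L.form x (y - x) = k := hk.symm
  have h : L.form y y = L.form x x + 2 * k + 2 * m := by
    have h1 : y = x + (y - x) := by abel
    have h2 : L.form (y - x) x = k := by rw [L.symm.eq]; exact hk'
    rw [h1, LinearMap.BilinForm.add_left, LinearMap.BilinForm.add_right,
      LinearMap.BilinForm.add_right, hm, hk', h2]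
    ring
  have h3 : ((L.form y y / 2 : ℚ) : ℂ) = ((L.form x x / 2 : ℚ) : ℂ) + ((k + m : ℤ) : ℂ) := by
    rw [h]; push_cast; ring
  rw [h3, e, e, mul_add, Complex.exp_add]
  have h4 : Complex.exp (2 * (Real.pi : ℂ) * Complex.I * ((k + m : ℤ) : ℂ)) = 1 := by
    rw [mul_comm]; exact Complex.exp_int_mul_two_pi_mul_I _
  rw [h4, mul_one]

/-! ### The lattice `K = I^⊥/I` and the `Θ`-product -/

/-- `I` is a primitive isotropic sublattice of `L` of rank `p`, where `(p, q)` is the signature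
of `L`. -/
structure IsMaximalIsotropic (I : Submodule ℤ V) : Prop where
  le : I ≤ L.lat
  isotropic : ∀ x ∈ I, ∀ y ∈ I, L.form x y = 0
  primitive : ∀ x ∈ L.lat, ∀ m : ℤ, m ≠ 0 → m • x ∈ I → x ∈ I
  rank : Module.finrank ℤ I = L.sigPos

variable (I : Submodule ℤ V)

/-- `I_ℚ`. -/
abbrev IQ : Submodule ℚ V := Submodule.span ℚ (I : Set V)

/-- `I_ℚ^⊥`. -/
abbrev perp : Submodule ℚ V := L.form.orthogonal (IQ I)

/-- `I^* = I_ℚ ∩ L^∨`. -/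
def Istar : Submodule ℤ V := (IQ I).restrictScalars ℤ ⊓ L.form.dualSubmodule L.lat

/-- The overlattice `L^* = ⟨L, I^*⟩` of `L`. -/
def Lstar : Submodule ℤ V := L.lat ⊔ L.Istar I

/-- `K_ℚ = I_ℚ^⊥ / I_ℚ`. -/
abbrev KQ : Type _ := ↥(L.perp I) ⧸ (IQ I).submoduleOf (L.perp I)

/-- The bilinear form on `K_ℚ` induced by that of `L`. -/
def formK : LinearMap.BilinForm ℚ (L.KQ I) :=
  LinearMap.liftQ₂ _ _ (L.form.restrict (L.perp I))
    (fun x hx => LinearMap.ext fun y => y.2 x.1 hx)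
    (fun x hx => LinearMap.ext fun y => by
      have h : L.form x.1 y.1 = 0 := y.2 x.1 hx
      rw [L.symm.eq] at h
      exact h)

/-- The lattice `K = (I^⊥ ∩ L)/I`. -/
def K : Submodule ℤ (L.KQ I) :=
  (L.lat.comap ((L.perp I).subtype.restrictScalars ℤ)).map
    ((Submodule.mkQ ((IQ I).submoduleOf (L.perp I))).restrictScalars ℤ)

lemma mk_mem_dual_K (y : L.perp I) (hy : (y : V) ∈ L.form.dualSubmodule (L.Lstar I)) :
    (Submodule.Quotient.mk y : L.KQ I) ∈ (L.formK I).dualSubmodule (L.K I) := by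
  rintro _ ⟨x, hx, rfl⟩
  exact hy x ((le_sup_left : L.lat ≤ L.Lstar I) hx)

open Classical in
/-- The canonical isometry `A_{L^*} → A_K`. Given a splitting `L^* = φ(pU) ⊕ φ(pU)^⊥` with
`φ(I_p) = I^*`, every class of `A_{L^*}` has a representative in the dual lattice of
`φ(pU)^⊥ ⊆ I_ℚ^⊥`, and `φ(pU)^⊥ ≅ K` is the reduction modulo `I_ℚ`. So the isometry takes the
class of a `y ∈ (L^*)^∨ ∩ I_ℚ^⊥` to the class of `y mod I_ℚ` (which does not depend on the
choice of `y` or of the splitting). -/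
def discIso (a : Disc L.form (L.Lstar I)) : Disc (L.formK I) (L.K I) :=
  if h : ∃ (y : L.perp I) (hy : (y : V) ∈ L.form.dualSubmodule (L.Lstar I)),
      cls L.form (L.Lstar I) y hy = a then
    cls (L.formK I) (L.K I) (Submodule.Quotient.mk h.choose)
      (L.mk_mem_dual_K I h.choose h.choose_spec.choose)
  else 0

/-- The pushforward `↓^L_K : ℂA_L → ℂA_{L^*} = ℂA_K`. -/
def pushK : (L.A →₀ ℂ) →ₗ[ℂ] (Disc (L.formK I) (L.K I) →₀ ℂ) :=
  Finsupp.lmapDomain ℂ ℂ (L.discIso I) ∘ₗ pushforward L.form L.lat (L.Lstar I)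

/-- The contraction `⟨v, Θ_{K⁺}(τ)⟩` for `v ∈ ℂA_K`, where `K⁺ = K(-1)` and
`Θ_{K⁺}(τ) ∈ ℂA_{K⁺} = (ℂA_K)^∨`. -/
def contractTheta (τ : ℍ) : (Disc (L.formK I) (L.K I) →₀ ℂ) →ₗ[ℂ] ℂ :=
  Finsupp.linearCombination ℂ fun a =>
    theta (-L.formK I) (L.K I) τ (discNeg (L.formK I) (L.K I) a)

/-- `ξ(f) = ⟨f↓^L_K, Θ_{K⁺}⟩`. -/
def xi (f : ℍ → (L.A →₀ ℂ)) (τ : ℍ) : ℂ := L.contractTheta I τ (L.pushK I (f τ))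

/-- The `Θ`-product `f₁ ∗ f₂ = ⟨f₁↓^L_K, Θ_{K⁺}⟩ · f₂` with respect to `I`. -/
def thetaMul (f₁ f₂ : ℍ → (L.A →₀ ℂ)) : ℍ → (L.A →₀ ℂ) := fun τ => L.xi I f₁ τ • f₂ τ

/-- All functions `ℍ → ℂA_L`, as a type to carry the `Θ`-product. -/
def ThetaAlgebra (_L : EvenLattice V) (_I : Submodule ℤ V) : Type _ := ℍ → (_L.A →₀ ℂ)

instance : AddCommGroup (L.ThetaAlgebra I) :=
  inferInstanceAs (AddCommGroup (ℍ → (L.A →₀ ℂ)))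

/-- Pointwise addition and the `Θ`-product. -/
instance : NonUnitalRing (L.ThetaAlgebra I) where
  mul := L.thetaMul I
  left_distrib f g h := funext fun τ => smul_add (L.xi I f τ) (g τ) (h τ)
  right_distrib f g h := funext fun τ => by
    change L.contractTheta I τ (L.pushK I (f τ + g τ)) • h τ =
      L.contractTheta I τ (L.pushK I (f τ)) • h τ + L.contractTheta I τ (L.pushK I (g τ)) • h τ
    rw [map_add, map_add, add_smul]
  zero_mul f := funext fun τ => by
    change L.contractTheta I τ (L.pushK I 0) • f τ = 0
    rw [map_zero, map_zero, zero_smul]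
  mul_zero f := funext fun τ => smul_zero (L.xi I f τ)
  mul_assoc f g h := funext fun τ => by
    change L.contractTheta I τ (L.pushK I (L.xi I f τ • g τ)) • h τ =
      L.xi I f τ • L.xi I g τ • h τ
    rw [map_smul, map_smul, smul_smul]
    rfl

end EvenLattice

end

end ThetaProduct

open ThetaProduct

/-!
The coefficients of `Θ_{K⁺}` are nonnegative integers, so the point is that
`ξ(f) = ⟨f↓, Θ_{K⁺}⟩` is invariant under `Mp₂(ℤ)`: then `f₁ ∗ f₂ = ξ(f₁) f₂` transforms as `f₂`
does, and its Fourier coefficients are finite sums of products of those of `f₁`, `Θ_{K⁺}` and `f₂`.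

Write `ξ(f) = ∑_a f_a θ_a`, where `θ_a` is the theta series of the coset of `K` that corresponds to
`a ∈ A_L`, and is `0` if `a ∉ (L^*)^∨/L`. The lattice `K⁺` is positive definite of rank `-σ(L)`,
because `I` has rank `p`. Under `T` the phases of `f_a` and `θ_a` cancel. Poisson summation for
Gaussians shows that `τ ↦ -1/τ` acts on `(θ_a)` by the Fourier transform on `A_L`, up to a factor
`c (-iτ)^{-σ(L)/2}` with `c > 0`. At the fixed point `τ = i` the Fourier transform multiplies
`v = (θ_a(i))` by `c`, while its square multiplies the component `v_0 > 0` by `|A_L|`, so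
`c = √|A_L|`. This factor cancels against those of `ρ_L(S)` and of the weight of `f`.
-/

namespace ThetaProduct

noncomputable section

open MeasureTheory Module TopologicalSpace UnitAddTorus

section LatticeEquiv

variable {ι K V : Type*} [Fintype ι] [Field K] [CharZero K] [AddCommGroup V] [Module K V]

/-- The coordinates of the vectors of the lattice generated by a basis. -/
def latticeEquiv (b : Basis ι K V) : (ι → ℤ) ≃ₗ[ℤ] Submodule.span ℤ (Set.range b) :=
  (b.restrictScalars ℤ).equivFun.symm

lemma coe_latticeEquiv (b : Basis ι K V) (m : ι → ℤ) :
    (latticeEquiv b m : V) = ∑ i, m i • b i := by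
  simp [latticeEquiv, Basis.equivFun_symm_apply]

end LatticeEquiv

section Periodization

variable {ι : Type*}

/-- The inclusion of `ℤ^ι` into `ℝ^ι`. -/
def intVec : (ι → ℤ) →+ (ι → ℝ) := (Int.castAddHom ℝ).compLeft ι

@[simp] lemma intVec_apply (m : ι → ℤ) (i : ι) : intVec m i = m i := rfl

/-- The projection `ℝ^ι → ℝ^ι/ℤ^ι`. -/
def toTorus : C(ι → ℝ, UnitAddTorus ι) where
  toFun x i := (x i : UnitAddCircle)
  continuous_toFun := continuous_pi fun i => (AddCircle.continuous_mk' 1).comp (continuous_apply i)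

@[simp] lemma toTorus_apply (x : ι → ℝ) (i : ι) : toTorus x i = (x i : UnitAddCircle) := rfl

lemma isQuotientMap_toTorus : Topology.IsQuotientMap (toTorus : C(ι → ℝ, UnitAddTorus ι)) :=
  (IsOpenQuotientMap.piMap fun _ => QuotientAddGroup.isOpenQuotientMap_mk).isQuotientMap

lemma toTorus_add_intVec (x : ι → ℝ) (m : ι → ℤ) : toTorus (x + intVec m) = toTorus x := by
  funext i
  simp

lemma exists_eq_add_intVec_of_toTorus_eq {x y : ι → ℝ} (h : toTorus x = toTorus y) :
    ∃ m : ι → ℤ, y = x + intVec m := by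
  have hcoord (i : ι) : ∃ m : ℤ, (m : ℝ) = y i - x i := by
    have h0 : ((y i - x i : ℝ) : UnitAddCircle) = 0 := by
      rw [AddCircle.coe_sub, sub_eq_zero]
      exact (congrFun h i).symm
    simpa using (AddCircle.coe_eq_zero_iff _).1 h0
  choose m hm using hcoord
  exact ⟨m, funext fun i => by simp [hm]⟩

/-- Summability of the translates of `f` by `ℤ^ι`, uniformly on compact sets. -/
def LocallySummable (f : C(ι → ℝ, ℂ)) : Prop :=
  ∀ C : Compacts (ι → ℝ), Summable fun m => ‖(f.comp (.addRight (intVec m))).restrict C‖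

/-- The `ℤ^ι`-periodic function `x ↦ ∑_m f(x + m)`. It is only meaningful for a locally summable
`f`. -/
def periodization (f : C(ι → ℝ, ℂ)) : C(ι → ℝ, ℂ) := ∑' m, f.comp (.addRight (intVec m))

lemma norm_apply_add_intVec_le (f : C(ι → ℝ, ℂ)) (m : ι → ℤ) {C : Compacts (ι → ℝ)} {x : ι → ℝ}
    (hx : x ∈ C) : ‖f (x + intVec m)‖ ≤ ‖(f.comp (.addRight (intVec m))).restrict C‖ :=
  ((f.comp (.addRight (intVec m))).restrict C).norm_coe_le_norm (⟨x, hx⟩ : (C : Set (ι → ℝ)))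

lemma LocallySummable.mul_left {f g : C(ι → ℝ, ℂ)} (hf : LocallySummable f)
    (hg : ∀ x, ‖g x‖ ≤ 1) : LocallySummable (g * f) := fun C =>
  (hf C).of_nonneg_of_le (fun _ => norm_nonneg _) fun m =>
    (ContinuousMap.norm_le _ (norm_nonneg _)).2 fun x => by
      calc ‖g (x + intVec m) * f (x + intVec m)‖ ≤ ‖f (x + intVec m)‖ := by
            rw [norm_mul]
            exact mul_le_of_le_one_left (norm_nonneg _) (hg _)
        _ ≤ _ := norm_apply_add_intVec_le f m x.2

variable [Finite ι] {f : C(ι → ℝ, ℂ)}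

lemma LocallySummable.hasSum_periodization (hf : LocallySummable f) (x : ι → ℝ) :
    HasSum (fun m => f (x + intVec m)) (periodization f x) :=
  ContinuousMap.hasSum_apply (ContinuousMap.summable_of_locally_summable_norm hf).hasSum x

lemma LocallySummable.periodization_add_intVec (hf : LocallySummable f) (x : ι → ℝ) (n : ι → ℤ) :
    periodization f (x + intVec n) = periodization f x := by
  rw [← (hf.hasSum_periodization _).tsum_eq, ← (hf.hasSum_periodization _).tsum_eq,
    ← (Equiv.addLeft n).tsum_eq fun m => f (x + intVec m)]
  exact tsum_congr fun m => by simp [add_assoc]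

/-- The function on the torus `ℝ^ι/ℤ^ι` induced by the periodization of `f`. -/
def LocallySummable.torusPeriodization (hf : LocallySummable f) : C(UnitAddTorus ι, ℂ) :=
  isQuotientMap_toTorus.lift (periodization f) fun x y hxy => by
    obtain ⟨m, rfl⟩ := exists_eq_add_intVec_of_toTorus_eq hxy
    exact (hf.periodization_add_intVec x m).symm

lemma LocallySummable.torusPeriodization_toTorus (hf : LocallySummable f) (x : ι → ℝ) :
    hf.torusPeriodization (toTorus x) = periodization f x :=
  DFunLike.congr_fun (isQuotientMap_toTorus.lift_comp (periodization f) fun y z hyz => by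
    obtain ⟨m, rfl⟩ := exists_eq_add_intVec_of_toTorus_eq hyz
    exact (hf.periodization_add_intVec y m).symm) x

end Periodization

section PoissonSummation

variable {ι : Type*} [Fintype ι] {f : C(ι → ℝ, ℂ)}

variable (ι) in
/-- The closed unit cube in `ℝ^ι`. -/
def unitCube : Compacts (ι → ℝ) := ⟨Set.Icc 0 1, isCompact_Icc⟩

lemma LocallySummable.integrable (hf : LocallySummable f) : Integrable f := by
  let cube (m : ι → ℤ) : Compacts (ι → ℝ) := ⟨Set.Icc (intVec m) (intVec m + 1), isCompact_Icc⟩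
  refine integrable_of_summable_norm_restrict (s := cube) ?_ ?_
  · refine (hf (unitCube ι)).of_nonneg_of_le (fun m => by positivity) fun m => ?_
    have hvol : volume.real (cube m : Set (ι → ℝ)) = 1 := by
      change (volume (Set.Icc (intVec m) (intVec m + 1))).toReal = 1
      simp [Real.volume_Icc_pi]
    rw [hvol, mul_one]
    refine (ContinuousMap.norm_le _ (norm_nonneg _)).2 fun x => ?_
    have hx : (x : ι → ℝ) - intVec m ∈ unitCube ι := by
      have hmem : (x : ι → ℝ) ∈ Set.Icc (intVec m) (intVec m + 1) := x.2
      exact ⟨sub_nonneg.2 hmem.1, sub_le_iff_le_add'.2 hmem.2⟩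
    calc ‖f x‖ = ‖f (x - intVec m + intVec m)‖ := by rw [sub_add_cancel]
      _ ≤ _ := norm_apply_add_intVec_le f m hx
  · refine Set.eq_univ_of_forall fun x => Set.mem_iUnion.2 ⟨fun i => ⌊x i⌋, ?_, ?_⟩
    · exact fun i => Int.floor_le (x i)
    · exact fun i => (Int.lt_floor_add_one (x i)).le

lemma integral_eq_tsum_unitCube {f : (ι → ℝ) → ℂ} (hf : Integrable f) :
    ∫ x, f x = ∑' m, ∫ x in unitCube ι, f (x + intVec m) := by
  have : Countable (Submodule.span ℤ (Set.range (Pi.basisFun ℝ ι))).toAddSubgroup :=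
    (latticeEquiv (Pi.basisFun ℝ ι)).symm.injective.countable
  have hcube : ZSpan.fundamentalDomain (Pi.basisFun ℝ ι) =ᵐ[volume] (unitCube ι : Set (ι → ℝ)) := by
    rw [ZSpan.fundamentalDomain_pi_basisFun]
    exact Measure.univ_pi_Ico_ae_eq_Icc
  calc ∫ x, f x = ∑' g : Submodule.span ℤ (Set.range (Pi.basisFun ℝ ι)),
        ∫ x in ZSpan.fundamentalDomain (Pi.basisFun ℝ ι), f ((g : ι → ℝ) + x) :=
      (ZSpan.isAddFundamentalDomain' (Pi.basisFun ℝ ι) volume).integral_eq_tsum'' f hf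
    _ = ∑' m, ∫ x in unitCube ι, f (x + intVec m) := by
      rw [← (latticeEquiv (Pi.basisFun ℝ ι)).toEquiv.tsum_eq]
      refine tsum_congr fun m => ?_
      have hm : (latticeEquiv (Pi.basisFun ℝ ι) m : ι → ℝ) = intVec m := by
        classical
        ext j
        simp [coe_latticeEquiv, Pi.single_apply]
      simp only [setIntegral_congr_set hcube, LinearEquiv.coe_toEquiv, hm, add_comm]

lemma LocallySummable.setIntegral_unitCube_periodization (hf : LocallySummable f) :
    ∫ x in unitCube ι, periodization f x = ∫ x, f x := by
  have hfin : volume (unitCube ι : Set (ι → ℝ)) < ⊤ := (unitCube ι).isCompact.measure_lt_top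
  have hbound (m : ι → ℤ) (x : ι → ℝ) (hx : x ∈ (unitCube ι : Set (ι → ℝ))) :
      ‖‖f (x + intVec m)‖‖ ≤ ‖(f.comp (.addRight (intVec m))).restrict (unitCube ι)‖ := by
    simpa only [norm_norm] using norm_apply_add_intVec_le f m hx
  have hinteg (m : ι → ℤ) : IntegrableOn (fun x => f (x + intVec m)) (unitCube ι) :=
    (f.comp (.addRight (intVec m))).continuous.continuousOn.integrableOn_compact
      (unitCube ι).isCompact
  have hsum : Summable fun m => ∫ x in unitCube ι, ‖f (x + intVec m)‖ :=
    ((hf (unitCube ι)).mul_right _).of_norm_bounded fun m =>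
      norm_setIntegral_le_of_norm_le_const hfin (hbound m)
  rw [integral_eq_tsum_unitCube hf.integrable,
    integral_tsum_of_summable_integral_norm hinteg hsum]
  simp only [(hf.hasSum_periodization _).tsum_eq]

lemma mFourier_toTorus (n : ι → ℤ) (x : ι → ℝ) :
    mFourier n (toTorus x) = Complex.exp (2 * Real.pi * Complex.I * (intVec n ⬝ᵥ x : ℝ)) := by
  simp only [mFourier, ContinuousMap.coe_mk, toTorus_apply, fourier_coe_apply, ← Complex.exp_sum,
    dotProduct, intVec_apply, Complex.ofReal_sum, Finset.mul_sum]
  congr 1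
  exact Finset.sum_congr rfl fun i _ => by push_cast; ring

lemma LocallySummable.mFourierCoeff_torusPeriodization (hf : LocallySummable f) (n : ι → ℤ) :
    mFourierCoeff hf.torusPeriodization n = ∫ x, mFourier (-n) (toTorus x) * f x := by
  let χ : C(ι → ℝ, ℂ) := (mFourier (-n)).comp toTorus
  have hχf : LocallySummable (χ * f) := hf.mul_left fun x =>
    ((mFourier (-n)).norm_coe_le_norm (toTorus x)).trans_eq mFourier_norm
  have hper (x : ι → ℝ) : periodization (χ * f) x = χ x * periodization f x := by
    refine (hχf.hasSum_periodization x).unique ?_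
    have hχ (m : ι → ℤ) : χ (x + intVec m) = χ x := by
      simp only [χ, ContinuousMap.comp_apply, toTorus_add_intVec]
    simpa only [ContinuousMap.mul_apply, hχ] using (hf.hasSum_periodization x).mul_left (χ x)
  have hcube : {x : ι → ℝ | ∀ i, x i ∈ Set.Ioc ((0 : ι → ℝ) i) ((0 : ι → ℝ) i + 1)} =ᵐ[volume]
      (unitCube ι : Set (ι → ℝ)) := by
    have hpi : {x : ι → ℝ | ∀ i, x i ∈ Set.Ioc ((0 : ι → ℝ) i) ((0 : ι → ℝ) i + 1)} =
        Set.univ.pi fun i => Set.Ioc ((0 : ι → ℝ) i) ((1 : ι → ℝ) i) := by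
      ext x
      simp
    exact hpi ▸ Measure.univ_pi_Ioc_ae_eq_Icc
  calc mFourierCoeff hf.torusPeriodization n
      = ∫ x in unitCube ι, mFourier (-n) (toTorus x) • hf.torusPeriodization (toTorus x) := by
        rw [mFourierCoeff_eq_integral _ _ 0, setIntegral_congr_set hcube]
        rfl
    _ = ∫ x in unitCube ι, periodization (χ * f) x := by
        simp only [hf.torusPeriodization_toTorus, hper, smul_eq_mul]
        rfl
    _ = ∫ x, mFourier (-n) (toTorus x) * f x := hχf.setIntegral_unitCube_periodization

theorem LocallySummable.hasSum_mFourier (hf : LocallySummable f)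
    (hsum : Summable fun n => ∫ x, mFourier (-n) (toTorus x) * f x) (x : ι → ℝ) :
    HasSum (fun n => (∫ y, mFourier (-n) (toTorus y) * f y) * mFourier n (toTorus x))
      (∑' m, f (x + intVec m)) := by
  simp_rw [← hf.mFourierCoeff_torusPeriodization] at hsum ⊢
  rw [(hf.hasSum_periodization x).tsum_eq, ← hf.torusPeriodization_toTorus]
  exact hasSum_mFourier_series_apply_of_summable hsum (toTorus x)

end PoissonSummation

section GaussianPoisson

variable {ι E : Type*} [NormedAddCommGroup E]

lemma norm_cexp_neg_mul_norm_sq (b : ℂ) (y : E) :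
    ‖Complex.exp (-b * (‖y‖ : ℂ) ^ 2)‖ = Real.exp (-b.re * ‖y‖ ^ 2) := by
  rw [Complex.norm_exp, ← Complex.ofReal_pow, Complex.re_mul_ofReal, Complex.neg_re]

lemma exp_neg_mul_norm_sq_add_le {a R : ℝ} (ha : 0 < a) {w : E} (hw : ‖w‖ ≤ R) (y : E) :
    Real.exp (-a * ‖w + y‖ ^ 2) ≤ Real.exp (a * R ^ 2) * Real.exp (-(a / 2) * ‖y‖ ^ 2) := by
  have hy : ‖y‖ ≤ ‖w + y‖ + ‖w‖ := by simpa using norm_sub_le (w + y) w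
  have hsq : ‖y‖ ^ 2 ≤ 2 * ‖w + y‖ ^ 2 + 2 * R ^ 2 := by
    nlinarith [norm_nonneg y, norm_nonneg w, sq_nonneg (‖w + y‖ - ‖w‖)]
  rw [← Real.exp_add, Real.exp_le_exp]
  nlinarith

variable [Fintype ι] [InnerProductSpace ℝ E]

lemma equivFun_symm_intVec (v : Basis ι ℝ E) (m : ι → ℤ) :
    v.equivFun.symm (intVec m) = latticeEquiv v m := by
  simp [coe_latticeEquiv, Basis.equivFun_symm_apply, Int.cast_smul_eq_zsmul]

lemma dotProduct_eq_inner {v d : Basis ι ℝ E} [DecidableEq ι]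
    (hd : ∀ i j, inner ℝ (d i) (v j) = if i = j then 1 else 0) (n : ι → ℤ) (x : ι → ℝ) :
    intVec n ⬝ᵥ x = inner ℝ (v.equivFun.symm x) (latticeEquiv d n : E) := by
  simp [dotProduct, ← equivFun_symm_intVec, Basis.equivFun_symm_apply, sum_inner, inner_sum,
    real_inner_smul_right, real_inner_comm (d _), hd, mul_comm]

/-- The Gaussian `y ↦ exp(-b‖y‖²)` in the coordinates with respect to a basis. -/
def gaussian (v : Basis ι ℝ E) (b : ℂ) : C(ι → ℝ, ℂ) where
  toFun x := Complex.exp (-b * (‖v.equivFun.symm x‖ : ℂ) ^ 2)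
  continuous_toFun := by
    simp only [Basis.equivFun_symm_apply]
    fun_prop

lemma gaussian_add_intVec (v : Basis ι ℝ E) (b : ℂ) (x : ι → ℝ) (m : ι → ℤ) :
    gaussian v b (x + intVec m) =
      Complex.exp (-b * (‖v.equivFun.symm x + latticeEquiv v m‖ : ℂ) ^ 2) := by
  rw [← equivFun_symm_intVec, ← map_add]
  rfl

variable [FiniteDimensional ℝ E]

lemma summable_exp_neg_mul_norm_sq (Λ : Submodule ℤ E) [DiscreteTopology Λ] {a : ℝ} (ha : 0 < a)
    (w : E) : Summable fun y : Λ => Real.exp (-a * ‖w + y‖ ^ 2) := by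
  set k := finrank ℤ Λ + 1
  have hpow : Summable fun y : Λ => k.factorial / a ^ k * ‖(y : E) - -w‖⁻¹ ^ (2 * k) :=
    (ZLattice.summable_norm_sub_inv_pow Λ (2 * k) (by omega) (-w)).mul_left _
  refine hpow.of_norm_bounded_eventually ?_
  have hfin : {y : Λ | w + y = 0}.Finite := Set.Subsingleton.finite fun y hy z hz =>
    Subtype.ext (add_left_cancel (hy.trans hz.symm))
  refine hfin.subset fun y hy => ?_
  by_contra hne
  refine hy ?_
  have hpos : 0 < ‖w + y‖ := norm_pos_iff.2 hne
  have hexp := Real.pow_div_factorial_le_exp (a * ‖w + y‖ ^ 2) (by positivity) k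
  change ‖Real.exp (-a * ‖w + y‖ ^ 2)‖ ≤ k.factorial / a ^ k * ‖(y : E) - -w‖⁻¹ ^ (2 * k)
  rw [sub_neg_eq_add, add_comm (y : E), Real.norm_of_nonneg (Real.exp_pos _).le, neg_mul,
    Real.exp_neg, inv_le_comm₀ (Real.exp_pos _) (by positivity)]
  refine le_of_eq_of_le ?_ hexp
  rw [inv_pow, pow_mul, mul_pow]
  field_simp

lemma locallySummable_gaussian (v : Basis ι ℝ E) {b : ℂ} (hb : 0 < b.re) :
    LocallySummable (gaussian v b) := fun C => by
  obtain ⟨R, hR⟩ : ∃ R, ∀ x ∈ (C : Set (ι → ℝ)), ‖v.equivFun.symm x‖ ≤ R :=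
    C.isCompact.exists_bound_of_continuousOn v.equivFunL.symm.continuous.continuousOn
  have hsum : Summable fun m : ι → ℤ =>
      Real.exp (b.re * R ^ 2) * Real.exp (-(b.re / 2) * ‖(latticeEquiv v m : E)‖ ^ 2) := by
    have hΛ := summable_exp_neg_mul_norm_sq (Submodule.span ℤ (Set.range v)) (half_pos hb) 0
    simp only [zero_add] at hΛ
    exact (hΛ.comp_injective (latticeEquiv v).injective).mul_left _
  have hbound (m : ι → ℤ) (x : ι → ℝ) (hx : x ∈ (C : Set (ι → ℝ))) :
      ‖gaussian v b (x + intVec m)‖ ≤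
        Real.exp (b.re * R ^ 2) * Real.exp (-(b.re / 2) * ‖(latticeEquiv v m : E)‖ ^ 2) := by
    rw [gaussian_add_intVec, norm_cexp_neg_mul_norm_sq]
    exact exp_neg_mul_norm_sq_add_le hb (hR x hx) _
  exact hsum.of_nonneg_of_le (fun _ => norm_nonneg _) fun m =>
    (ContinuousMap.norm_le _ (by positivity)).2 fun x => hbound m x x.2

variable [MeasurableSpace E] [BorelSpace E]

lemma exists_integral_comp_continuousLinearEquiv {F G : Type*} [NormedAddCommGroup F]
    [NormedSpace ℝ F] [MeasureSpace F] [BorelSpace F] [(volume : Measure F).IsAddHaarMeasure]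
    [NormedAddCommGroup G] [NormedSpace ℝ G] (T : F ≃L[ℝ] E) :
    ∃ c : ℝ, 0 < c ∧ ∀ f : E → G, ∫ x, f (T x) = c • ∫ y, f y := by
  have hT : MeasurableEmbedding T := T.toHomeomorph.measurableEmbedding
  have : (Measure.map T (volume : Measure F)).IsAddHaarMeasure := T.isAddHaarMeasure_map volume
  have hmap := Measure.isAddLeftInvariant_eq_smul (Measure.map T (volume : Measure F))
    (volume : Measure E)
  set c := (Measure.map T (volume : Measure F)).addHaarScalarFactor (volume : Measure E)
  have hc : c ≠ 0 := by
    intro h0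
    rw [h0, zero_smul] at hmap
    exact NeZero.ne (Measure.map T (volume : Measure F)) hmap
  refine ⟨c, by positivity, fun f => ?_⟩
  rw [← hT.integral_map, hmap, integral_smul_nnreal_measure]
  rfl

theorem exists_integral_mFourier_mul_gaussian {v d : Basis ι ℝ E} [DecidableEq ι]
    (hd : ∀ i j, inner ℝ (d i) (v j) = if i = j then 1 else 0) :
    ∃ c : ℝ, 0 < c ∧ ∀ (b : ℂ), 0 < b.re → ∀ n : ι → ℤ,
      ∫ x, mFourier (-n) (toTorus x) * gaussian v b x = c * ((Real.pi / b) ^ (finrank ℝ E / 2 : ℂ) *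
        Complex.exp (-Real.pi ^ 2 * (‖(latticeEquiv d n : E)‖ : ℂ) ^ 2 / b)) := by
  obtain ⟨c, hc, hint⟩ := exists_integral_comp_continuousLinearEquiv (G := ℂ) v.equivFunL.symm
  refine ⟨c, hc, fun b hb n => ?_⟩
  rw [← fourier_gaussian_innerProductSpace hb, Real.fourier_eq', ← Complex.real_smul, ← hint]
  congr 1
  funext x
  have hx : inner ℝ (v.equivFunL.symm x) (latticeEquiv d n : E) = intVec n ⬝ᵥ x :=
    (dotProduct_eq_inner hd n x).symm
  rw [mFourier_toTorus, smul_eq_mul, hx, map_neg, neg_dotProduct]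
  congr 2
  push_cast
  ring

theorem exists_tsum_gaussian_eq {κ : Type*} [Finite κ] [DecidableEq κ] {v d : Basis κ ℝ E}
    (hd : ∀ i j, inner ℝ (d i) (v j) = if i = j then 1 else 0) :
    ∃ c : ℝ, 0 < c ∧ ∀ (b : ℂ), 0 < b.re → ∀ w : E,
      ∑' y : Submodule.span ℤ (Set.range v), Complex.exp (-b * (‖w + y‖ : ℂ) ^ 2) =
        c * (Real.pi / b) ^ (finrank ℝ E / 2 : ℂ) * ∑' z : Submodule.span ℤ (Set.range d),
          Complex.exp (-Real.pi ^ 2 * (‖(z : E)‖ : ℂ) ^ 2 / b +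
            2 * Real.pi * Complex.I * (inner ℝ w (z : E) : ℝ)) := by
  have := Fintype.ofFinite κ
  obtain ⟨c, hc, hcoeff⟩ := exists_integral_mFourier_mul_gaussian hd
  refine ⟨c, hc, fun b hb w => ?_⟩
  have hb' : 0 < (Real.pi ^ 2 / b : ℂ).re := by
    have hb0 : b ≠ 0 := by rintro rfl; simp at hb
    rw [div_eq_mul_inv, ← Complex.ofReal_pow, Complex.re_ofReal_mul, Complex.inv_re]
    have := Complex.normSq_pos.2 hb0
    positivity
  have hsum : Summable fun n => ∫ x, mFourier (-n) (toTorus x) * gaussian v b x := by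
    simp_rw [hcoeff b hb]
    refine Summable.mul_left _ (Summable.mul_left _ (Summable.of_norm ?_))
    refine ((latticeEquiv d).toEquiv.summable_iff.2
      (summable_exp_neg_mul_norm_sq (Submodule.span ℤ (Set.range d)) hb' 0)).congr fun n => ?_
    rw [Function.comp_apply, zero_add, ← norm_cexp_neg_mul_norm_sq]
    congr 2
    simp only [LinearEquiv.coe_toEquiv]
    ring
  rw [← (latticeEquiv v).toEquiv.tsum_eq, ← (latticeEquiv d).toEquiv.tsum_eq, ← tsum_mul_left]
  have hPoisson := ((locallySummable_gaussian v hb).hasSum_mFourier hsum (v.equivFun w)).tsum_eq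
  simp only [gaussian_add_intVec, LinearEquiv.symm_apply_apply] at hPoisson
  refine hPoisson.symm.trans (tsum_congr fun n => ?_)
  rw [hcoeff b hb, mFourier_toTorus, dotProduct_eq_inner hd, LinearEquiv.symm_apply_apply,
    Complex.exp_add]
  simp only [LinearEquiv.coe_toEquiv]
  ring

end GaussianPoisson

section Exponential

lemma e_add (x y : ℂ) : e (x + y) = e x * e y := by
  rw [e, e, e, ← Complex.exp_add, mul_add]

lemma e_zero : e 0 = 1 := by simp [e]

lemma e_ne_zero (x : ℂ) : e x ≠ 0 := Complex.exp_ne_zero _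

lemma e_intCast (m : ℤ) : e (m : ℂ) = 1 := by
  rw [e, mul_comm]
  exact Complex.exp_int_mul_two_pi_mul_I m

lemma e_ratCast_eq_one_iff {x : ℚ} : e (x : ℂ) = 1 ↔ ∃ m : ℤ, x = m := by
  refine Complex.exp_eq_one_iff.trans (exists_congr fun m => ?_)
  rw [mul_comm, mul_left_inj' Complex.two_pi_I_ne_zero]
  norm_cast

lemma e_ratCast_eq_of_sub {x y : ℚ} (m : ℤ) (h : x - y = m) : e (x : ℂ) = e (y : ℂ) := by
  rw [sub_eq_iff_eq_add.1 h, Rat.cast_add, e_add, Rat.cast_intCast, e_intCast, one_mul]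

lemma norm_e (x : ℂ) : ‖e x‖ = Real.exp (-2 * Real.pi * x.im) := by
  rw [e, Complex.norm_exp]
  congr 1
  simp [Complex.mul_re, Complex.mul_im]

end Exponential

section PosDefLattice

variable {W : Type*} [AddCommGroup W] [Module ℚ W]

lemma nondegenerate_of_posDef {B : LinearMap.BilinForm ℚ W} (hs : B.IsSymm)
    (hpos : B.toQuadraticMap.PosDef) : B.Nondegenerate :=
  (LinearMap.IsRefl.nondegenerate_iff_separatingLeft hs.isRefl).2 fun x hx =>
    by_contra fun h => (hpos x h).ne' (hx x)

lemma exists_basis_span_eq (N : Submodule ℤ W) [Submodule.IsLattice ℚ N] :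
    ∃ b : Basis (Fin (finrank ℚ W)) ℚ W, N = Submodule.span ℤ (Set.range b) := by
  have : Module.Free ℤ N := Submodule.IsLattice.free ℚ N
  have : Module.Finite ℤ N := Submodule.IsLattice.finite ℚ N
  have hrank : finrank ℤ N = finrank ℚ W :=
    congrArg Cardinal.toNat (Submodule.IsLattice.rank' ℚ N)
  let b := Module.finBasisOfFinrankEq ℤ N hrank
  refine ⟨b.extendOfIsLattice ℚ, ?_⟩
  have hrange : Set.range (b.extendOfIsLattice ℚ) = N.subtype '' Set.range b := by
    rw [← Set.range_comp]
    congr 1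
    funext i
    simp
  rw [hrange, ← Submodule.map_span, b.span_eq, Submodule.map_top, Submodule.range_subtype]

lemma exists_isometry_euclidean [FiniteDimensional ℚ W] {B : LinearMap.BilinForm ℚ W}
    (hs : B.IsSymm) (hpos : B.toQuadraticMap.PosDef) :
    ∃ φ : W →+ EuclideanSpace ℝ (Fin (finrank ℚ W)),
      ∀ x y, inner ℝ (φ x) (φ y) = (B x y : ℚ) := by
  have : Invertible (2 : ℚ) := invertibleOfNonzero two_ne_zero
  obtain ⟨v, hv⟩ := LinearMap.BilinForm.exists_orthogonal_basis (K := ℚ) (B := B)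
    (LinearMap.BilinForm.isSymm_iff.1 hs)
  have hd (i) : (0 : ℝ) ≤ (B (v i) (v i) : ℚ) := by exact_mod_cast (hpos _ (v.ne_zero i)).le
  refine ⟨AddMonoidHom.mk'
    (fun x => WithLp.toLp 2 fun i => (v.repr x i : ℝ) * √(B (v i) (v i) : ℚ))
    fun x y => by ext i; simp [add_mul], fun x y => ?_⟩
  have hB : B x y = ∑ i, v.repr x i * v.repr y i * B (v i) (v i) := by
    conv_lhs => rw [← v.sum_repr x, ← v.sum_repr y]
    simp only [map_sum, LinearMap.sum_apply, map_smul, LinearMap.smul_apply, smul_eq_mul]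
    refine Finset.sum_congr rfl fun i _ => ?_
    rw [Finset.sum_eq_single i (fun j _ hj => ?_) (by simp)]
    · ring
    · have horth : B (v j) (v i) = 0 := hv hj
      rw [horth, mul_zero]
  rw [hB, PiLp.inner_apply]
  push_cast
  refine Finset.sum_congr rfl fun i _ => ?_
  simp only [AddMonoidHom.mk'_apply, RCLike.inner_apply, conj_trivial]
  linear_combination (v.repr x i : ℝ) * (v.repr y i : ℝ) * Real.mul_self_sqrt (hd i)

section Isometry

variable {B : LinearMap.BilinForm ℚ W} {E : Type*} [NormedAddCommGroup E] [InnerProductSpace ℝ E]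
  {φ : W →+ E} {ι : Type*} [Finite ι] {b : Basis ι ℚ W}

lemma linearIndependent_isometry (hs : B.IsSymm) (hB : B.Nondegenerate)
    (hφ : ∀ x y, inner ℝ (φ x) (φ y) = (B x y : ℚ)) (b : Basis ι ℚ W) :
    LinearIndependent ℝ fun i => φ (b i) := by
  classical
  have := Fintype.ofFinite ι
  refine Fintype.linearIndependent_iff.2 fun c hc j => ?_
  have h := congrArg (fun y => inner ℝ y (φ (B.dualBasis hB b j))) hc
  simpa [sum_inner, real_inner_smul_left, hφ, hs.eq _ (B.dualBasis hB b j),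
    LinearMap.BilinForm.apply_dualBasis_left, apply_ite (Rat.cast : ℚ → ℝ)] using h

lemma tsum_span_isometry {v : Basis ι ℝ E} (hv : ∀ i, v i = φ (b i)) (f : E → ℂ) :
    ∑' y : Submodule.span ℤ (Set.range v), f y =
      ∑' x : Submodule.span ℤ (Set.range b), f (φ x) := by
  have := Fintype.ofFinite ι
  rw [← (latticeEquiv v).toEquiv.tsum_eq, ← (latticeEquiv b).toEquiv.tsum_eq]
  simp [coe_latticeEquiv, hv]

lemma e_form_mul (hφ : ∀ x y, inner ℝ (φ x) (φ y) = (B x y : ℚ)) (τ : ℂ) (x : W) :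
    e ((B x x / 2 : ℚ) * τ) = Complex.exp (-(Real.pi * (-Complex.I * τ)) * (‖φ x‖ : ℂ) ^ 2) := by
  rw [← Complex.ofReal_pow, ← real_inner_self_eq_norm_sq, hφ, e]
  congr 1
  push_cast
  ring

lemma e_form_mul_neg_inv (hφ : ∀ x y, inner ℝ (φ x) (φ y) = (B x y : ℚ)) {τ : ℂ} (hτ : τ ≠ 0)
    (w z : W) : e ((B z z / 2 : ℚ) * (-1 / τ)) * e (B w z : ℚ) =
      Complex.exp (-Real.pi ^ 2 * (‖φ z‖ : ℂ) ^ 2 / (Real.pi * (-Complex.I * τ)) +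
        2 * Real.pi * Complex.I * (inner ℝ (φ w) (φ z) : ℝ)) := by
  have hπ : (Real.pi : ℂ) ≠ 0 := by exact_mod_cast Real.pi_ne_zero
  rw [← Complex.ofReal_pow ‖_‖, ← real_inner_self_eq_norm_sq, hφ, hφ, e, e, ← Complex.exp_add]
  congr 1
  push_cast
  field_simp
  linear_combination -(B z z : ℂ) * Complex.I_sq

end Isometry

lemma cpow_mul_cpow_pi_div (τ : ℍ) (s : ℂ) :
    (-Complex.I * τ) ^ s * (Real.pi / (Real.pi * (-Complex.I * τ))) ^ s = 1 := by
  have hre : 0 < (-Complex.I * τ : ℂ).re := by simpa using τ.im_pos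
  have hne : (-Complex.I * τ : ℂ) ≠ 0 := fun h => by simp [h] at hre
  have hπ : (Real.pi : ℂ) ≠ 0 := by exact_mod_cast Real.pi_ne_zero
  have hinv : (Real.pi / (Real.pi * (-Complex.I * τ)) : ℂ) = (-Complex.I * τ)⁻¹ := by field_simp
  rw [hinv, Complex.inv_cpow _ _ fun harg => hre.not_gt (Complex.arg_eq_pi_iff.1 harg).1]
  exact mul_inv_cancel₀ ((Complex.cpow_ne_zero_iff).2 (Or.inl hne))

variable {B : LinearMap.BilinForm ℚ W}

lemma exists_real_basis (hs : B.IsSymm) (hB : B.Nondegenerate)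
    {φ : W →+ EuclideanSpace ℝ (Fin (finrank ℚ W))}
    (hφ : ∀ x y, inner ℝ (φ x) (φ y) = (B x y : ℚ)) (b : Basis (Fin (finrank ℚ W)) ℚ W) :
    ∃ v : Basis (Fin (finrank ℚ W)) ℝ (EuclideanSpace ℝ (Fin (finrank ℚ W))),
      ∀ i, v i = φ (b i) := by
  have hcard : Fintype.card (Fin (finrank ℚ W)) =
    finrank ℝ (EuclideanSpace ℝ (Fin (finrank ℚ W))) := by simp
  have hli := linearIndependent_isometry hs hB hφ b
  exact ⟨basisOfTopLeSpanOfCardEqFinrank _ (hli.span_eq_top_of_card_eq_finrank' hcard).ge hcard,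
    fun i => by simp⟩

variable [FiniteDimensional ℚ W] (hs : B.IsSymm) (hpos : B.toQuadraticMap.PosDef)
  (N : Submodule ℤ W) [Submodule.IsLattice ℚ N]
include hs hpos

lemma summable_exp_neg_form (w : W) {a : ℝ} (ha : 0 < a) :
    Summable fun k : N => Real.exp (-a * (B (w + k) (w + k) : ℚ)) := by
  obtain ⟨φ, hφ⟩ := exists_isometry_euclidean hs hpos
  obtain ⟨b, rfl⟩ := exists_basis_span_eq N
  obtain ⟨v, hv⟩ := exists_real_basis hs (nondegenerate_of_posDef hs hpos) hφ b
  have hsum := summable_exp_neg_mul_norm_sq (Submodule.span ℤ (Set.range v)) ha (φ w)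
  have hcomp := hsum.comp_injective (latticeEquiv v).injective
  refine ((latticeEquiv b).toEquiv.summable_iff).1 (hcomp.congr fun m => ?_)
  have hm : (latticeEquiv v m : EuclideanSpace ℝ _) = φ (latticeEquiv b m) := by
    simp [coe_latticeEquiv, hv]
  simp only [Function.comp_apply, LinearEquiv.coe_toEquiv]
  rw [hm, ← map_add, ← real_inner_self_eq_norm_sq, hφ]

/-- The constant is the square root of the order of the discriminant group. -/
theorem exists_theta_inversion :
    ∃ c : ℝ, 0 < c ∧ ∀ (τ : ℍ) (w : W),
      ∑' z : B.dualSubmodule N, e ((B z z / 2 : ℚ) * (-1 / τ)) * e (B w z : ℚ) =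
        c * (-Complex.I * τ) ^ (finrank ℚ W / 2 : ℂ) *
          ∑' k : N, e ((B (w + k) (w + k) / 2 : ℚ) * τ) := by
  have hB := nondegenerate_of_posDef hs hpos
  obtain ⟨φ, hφ⟩ := exists_isometry_euclidean hs hpos
  obtain ⟨b, rfl⟩ := exists_basis_span_eq N
  obtain ⟨v, hv⟩ := exists_real_basis hs hB hφ b
  obtain ⟨d, hd⟩ := exists_real_basis hs hB hφ (B.dualBasis hB b)
  have hdual (i j) : inner ℝ (d i) (v j) = if i = j then (1 : ℝ) else 0 := by
    rw [hd, hv, hφ, LinearMap.BilinForm.apply_dualBasis_left]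
    rcases eq_or_ne i j with rfl | hij
    · simp
    · simp [hij, hij.symm]
  obtain ⟨c, hc, hPoisson⟩ := exists_tsum_gaussian_eq hdual
  refine ⟨c⁻¹, inv_pos.2 hc, fun τ w => ?_⟩
  have hre : 0 < (Real.pi * (-Complex.I * τ) : ℂ).re := by
    simpa [Complex.re_ofReal_mul] using mul_pos Real.pi_pos τ.im_pos
  have hc' : (c : ℂ) ≠ 0 := by exact_mod_cast hc.ne'
  have hinv := hPoisson _ hre (φ w)
  rw [tsum_span_isometry hv fun y => Complex.exp (-_ * (‖φ w + y‖ : ℂ) ^ 2),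
    tsum_span_isometry hd fun z => Complex.exp (-Real.pi ^ 2 * (‖z‖ : ℂ) ^ 2 / _ +
      2 * Real.pi * Complex.I * (inner ℝ (φ w) z : ℝ)), finrank_euclideanSpace_fin] at hinv
  simp_rw [← map_add φ, ← e_form_mul hφ, ← e_form_mul_neg_inv hφ τ.ne_zero] at hinv
  rw [LinearMap.BilinForm.dualSubmodule_span_of_basis (R := ℤ) B hB b, hinv, Complex.ofReal_inv,
    mul_assoc, ← mul_assoc (_ ^ _), mul_left_comm (_ ^ _), cpow_mul_cpow_pi_div, mul_one,
    inv_mul_cancel_left₀ hc']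

end PosDefLattice

section Discriminant

variable {V : Type*} [AddCommGroup V] [Module ℚ V] {B : LinearMap.BilinForm ℚ V}

lemma mem_dualSubmodule_iff {N : Submodule ℤ V} {x : V} :
    x ∈ B.dualSubmodule N ↔ ∀ y ∈ N, ∃ m : ℤ, B x y = m := by
  simp only [LinearMap.BilinForm.mem_dualSubmodule, Submodule.mem_one, algebraMap_int_eq,
    eq_intCast, eq_comm]

lemma exists_zsmul_mem (N : Submodule ℤ V) [Submodule.IsLattice ℚ N] (y : V) :
    ∃ k : ℤ, k ≠ 0 ∧ k • y ∈ N := by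
  have hy : y ∈ Submodule.span ℚ (N : Set V) := by
    rw [Submodule.IsLattice.span_eq_top (A := ℚ) (M := N)]
    exact Submodule.mem_top
  obtain ⟨k, hk⟩ := multiple_mem_span_of_mem_localization_span (nonZeroDivisors ℤ) ℚ _ y hy
  rw [Submodule.span_eq] at hk
  exact ⟨k, nonZeroDivisors.coe_ne_zero k, hk⟩

section Representatives

variable {N : Submodule ℤ V}

lemma rep_mem (a : Disc B N) : rep a ∈ B.dualSubmodule N := (Quotient.out a).2

lemma cls_rep (a : Disc B N) : cls B N (rep a) (rep_mem a) = a := Quotient.out_eq a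

lemma cls_eq_cls_iff {x y : V} (hx : x ∈ B.dualSubmodule N) (hy : y ∈ B.dualSubmodule N) :
    cls B N x hx = cls B N y hy ↔ x - y ∈ N :=
  Submodule.Quotient.eq (N.submoduleOf (B.dualSubmodule N))

lemma cls_eq_iff {x : V} (hx : x ∈ B.dualSubmodule N) (a : Disc B N) :
    cls B N x hx = a ↔ x - rep a ∈ N := by
  rw [← cls_eq_cls_iff hx (rep_mem a), cls_rep]

lemma rep_cls_sub_mem {x : V} (hx : x ∈ B.dualSubmodule N) : rep (cls B N x hx) - x ∈ N := by
  rw [← cls_eq_cls_iff (rep_mem _) hx, cls_rep]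

lemma rep_add_sub_mem (a b : Disc B N) : rep (a + b) - (rep a + rep b) ∈ N := by
  have hab : a + b = cls B N (rep a + rep b) (add_mem (rep_mem a) (rep_mem b)) := by
    conv_lhs => rw [← cls_rep a, ← cls_rep b]
    rfl
  rw [hab]
  exact rep_cls_sub_mem _

lemma rep_mem_iff (a : Disc B N) : rep a ∈ N ↔ a = 0 := by
  rw [← neg_mem_iff, ← zero_sub, ← cls_eq_iff (zero_mem _) a, eq_comm]
  rfl

/-- The character `a ↦ e((μ, a))` of the discriminant group. -/
def discChar {μ : V} (hμ : μ ∈ B.dualSubmodule N) : AddChar (Disc B N) ℂ where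
  toFun a := e ((B μ (rep a) : ℚ) : ℂ)
  map_zero_eq_one' :=
    e_ratCast_eq_one_iff.2 (mem_dualSubmodule_iff.1 hμ _ ((rep_mem_iff 0).2 rfl))
  map_add_eq_mul' a b := by
    obtain ⟨m, hm⟩ := mem_dualSubmodule_iff.1 hμ _ (rep_add_sub_mem a b)
    rw [← e_add, ← Rat.cast_add, ← map_add]
    exact e_ratCast_eq_of_sub m (by rw [← hm, map_sub])

lemma discChar_apply {μ : V} (hμ : μ ∈ B.dualSubmodule N) (a : Disc B N) :
    discChar hμ a = e ((B μ (rep a) : ℚ) : ℂ) := rfl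

lemma discChar_cls {μ x : V} (hμ : μ ∈ B.dualSubmodule N) (hx : x ∈ B.dualSubmodule N) :
    discChar hμ (cls B N x hx) = e ((B μ x : ℚ) : ℂ) := by
  obtain ⟨m, hm⟩ := mem_dualSubmodule_iff.1 hμ _ (rep_cls_sub_mem hx)
  exact e_ratCast_eq_of_sub m (by rw [← hm, map_sub])

end Representatives

lemma exists_projection_inf (N : Submodule ℤ V) [Module.Finite ℤ N] (P : Submodule ℚ V) :
    ∃ π : N →ₗ[ℤ] N, (∀ y, (π y : V) ∈ P) ∧ ∀ y : N, (y : V) ∈ P → π y = y := by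
  have : Module.IsTorsionFree ℤ V := .trans_faithfulSMul ℤ ℚ V
  let Q : Submodule ℤ N := (P.restrictScalars ℤ).comap N.subtype
  have hQ (y : N) : y ∈ Q ↔ (y : V) ∈ P := Iff.rfl
  have : Module.IsTorsionFree ℤ (N ⧸ Q) := by
    rw [Module.isTorsionFree_iff_smul_eq_zero]
    intro r m h
    obtain ⟨y, rfl⟩ := Submodule.Quotient.mk_surjective Q m
    rw [← Submodule.Quotient.mk_smul, Submodule.Quotient.mk_eq_zero, hQ, Submodule.coe_smul,
      ← Int.cast_smul_eq_zsmul ℚ] at h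
    rw [Submodule.Quotient.mk_eq_zero, hQ, or_iff_not_imp_left]
    exact fun hr => (P.smul_mem_iff (by exact_mod_cast hr)).1 h
  have : Module.Free ℤ (N ⧸ Q) := Module.free_of_finite_type_torsion_free'
  obtain ⟨s, hs⟩ := LinearMap.exists_rightInverse_of_surjective Q.mkQ
    (LinearMap.range_eq_top.2 Q.mkQ_surjective)
  refine ⟨LinearMap.id - s ∘ₗ Q.mkQ, fun y => ?_, fun y hy => ?_⟩
  · rw [← hQ, ← Submodule.Quotient.mk_eq_zero]
    exact (Submodule.Quotient.mk_sub Q).trans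
      (sub_eq_zero.2 (LinearMap.congr_fun hs (Q.mkQ y)).symm)
  · have hy0 : Q.mkQ y = 0 := (Submodule.Quotient.mk_eq_zero _).2 hy
    simp [hy0]

variable {N : Submodule ℤ V} [Submodule.IsLattice ℚ N]

section Dual

variable (hB : B.Nondegenerate)
include hB

variable (N) in
lemma isLattice_dualSubmodule : Submodule.IsLattice ℚ (B.dualSubmodule N) := by
  obtain ⟨b, rfl⟩ := exists_basis_span_eq N
  rw [LinearMap.BilinForm.dualSubmodule_span_of_basis (R := ℤ) B hB b]
  exact ⟨Submodule.fg_span (Set.finite_range _), by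
    rw [Submodule.span_span_of_tower, Basis.span_eq]⟩

variable (N) in
lemma dualSubmodule_dualSubmodule (hs : B.IsSymm) : B.dualSubmodule (B.dualSubmodule N) = N := by
  obtain ⟨b, rfl⟩ := exists_basis_span_eq N
  exact LinearMap.BilinForm.dualSubmodule_dualSubmodule_of_basis B hB hs b

lemma exists_forall_apply_eq (f : N →ₗ[ℤ] ℚ) : ∃ u, ∀ y : N, B u y = f y := by
  obtain ⟨b, rfl⟩ := exists_basis_span_eq N
  have : FiniteDimensional ℚ V := .of_basis b
  let bN := b.restrictScalars ℤ
  refine ⟨(B.toDual hB).symm (b.constr ℚ (f ∘ bN)), fun y => ?_⟩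
  rw [LinearMap.BilinForm.apply_toDual_symm_apply]
  refine LinearMap.congr_fun (bN.ext fun i => ?_ : ((b.constr ℚ (f ∘ bN)).restrictScalars ℤ) ∘ₗ
    (Submodule.span ℤ (Set.range b)).subtype = f) y
  simp [bN]

lemma exists_mem_dualSubmodule_of_integral (P : Submodule ℚ V) (x : V)
    (hx : ∀ y ∈ N, y ∈ P → ∃ m : ℤ, B x y = m) :
    ∃ u ∈ B.dualSubmodule N, ∀ y ∈ P, B u y = B x y := by
  obtain ⟨π, hπP, hπ⟩ := exists_projection_inf N P
  obtain ⟨u, hu⟩ := exists_forall_apply_eq hB ((B x).restrictScalars ℤ ∘ₗ N.subtype ∘ₗ π)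
  refine ⟨u, mem_dualSubmodule_iff.2 fun y hy => ?_, fun y hy => ?_⟩
  · rw [hu ⟨y, hy⟩]
    exact hx _ (π _).2 (hπP _)
  · obtain ⟨k, hk, hky⟩ := exists_zsmul_mem N y
    have hkP : k • y ∈ P := by
      rw [← Int.cast_smul_eq_zsmul ℚ]
      exact P.smul_mem _ hy
    have hk_eq : B u (k • y) = B x (k • y) := by
      rw [hu ⟨k • y, hky⟩, LinearMap.comp_apply, LinearMap.comp_apply, hπ _ hkP]
      rfl
    rw [map_zsmul, map_zsmul] at hk_eq
    exact smul_right_injective ℚ hk hk_eq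

variable (N) in
lemma finite_disc : Finite (Disc B N) := by
  have := isLattice_dualSubmodule N hB
  refine Module.finite_of_fg_torsion _ fun {a} => ?_
  obtain ⟨k, hk, hka⟩ := exists_zsmul_mem N (rep a)
  refine ⟨⟨k, mem_nonZeroDivisors_of_ne_zero hk⟩, ?_⟩
  rw [← cls_rep a]
  exact (Submodule.Quotient.mk_eq_zero _).2 hka

end Dual

lemma discChar_eq_zero_iff (hB : B.Nondegenerate) (hs : B.IsSymm) {μ : V}
    (hμ : μ ∈ B.dualSubmodule N) : discChar hμ = 0 ↔ μ ∈ N := by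
  constructor
  · intro h
    rw [← dualSubmodule_dualSubmodule N hB hs]
    refine mem_dualSubmodule_iff.2 fun y hy => ?_
    rw [← e_ratCast_eq_one_iff, ← discChar_cls hμ hy, h, AddChar.zero_apply]
  · intro h
    ext a
    rw [discChar_apply, AddChar.zero_apply, e_ratCast_eq_one_iff, hs.eq]
    exact mem_dualSubmodule_iff.1 (rep_mem a) _ h

open Classical in
lemma sum_e_rep (hB : B.Nondegenerate) (hs : B.IsSymm) [Fintype (Disc B N)] {μ : V}
    (hμ : μ ∈ B.dualSubmodule N) :
    ∑ a : Disc B N, e ((B μ (rep a) : ℚ) : ℂ) =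
      if μ ∈ N then (Fintype.card (Disc B N) : ℂ) else 0 := by
  simp_rw [← discChar_apply hμ, AddChar.sum_eq_ite, discChar_eq_zero_iff hB hs]

end Discriminant

lemma neg_dualSubmodule {V : Type*} [AddCommGroup V] [Module ℚ V] (B : LinearMap.BilinForm ℚ V)
    (N : Submodule ℤ V) : (-B).dualSubmodule N = B.dualSubmodule N :=
  le_antisymm (by simpa using dualSubmodule_le_neg (-B) N) (dualSubmodule_le_neg B N)

namespace EvenLattice

variable {V : Type*} [AddCommGroup V] [Module ℚ V] (L : EvenLattice V) (I : Submodule ℤ V)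

instance isLattice_lat : Submodule.IsLattice ℚ L.lat := ⟨L.fg, L.span_eq_top⟩

lemma lat_le_dual : L.lat ≤ L.form.dualSubmodule L.lat := fun x hx =>
  mem_dualSubmodule_iff.2 (L.integral x hx)

lemma formK_mk (x y : L.perp I) :
    L.formK I (Submodule.Quotient.mk x) (Submodule.Quotient.mk y) = L.form x y := rfl

lemma isSymm_formK : (L.formK I).IsSymm := ⟨fun a b => by
  obtain ⟨x, rfl⟩ := Submodule.Quotient.mk_surjective _ a
  obtain ⟨y, rfl⟩ := Submodule.Quotient.mk_surjective _ b
  exact L.symm.eq x.1 y.1⟩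

lemma form_eq_zero_of_mem_perp {x y : V} (hx : x ∈ L.perp I) (hy : y ∈ IQ I) :
    L.form x y = 0 := by
  rw [L.symm.eq]
  exact hx y hy

variable {I} in
lemma IQ_le_perp (hI : ∀ x ∈ I, ∀ y ∈ I, L.form x y = 0) : IQ I ≤ L.perp I := by
  refine Submodule.span_le.2 fun y hy x hx => ?_
  have hker : IQ I ≤ LinearMap.ker (L.form.flip y) := Submodule.span_le.2 fun x hx => hI x hx y hy
  exact hker hx

lemma mk_eq_mk_iff (x y : L.perp I) :
    (Submodule.Quotient.mk x : L.KQ I) = Submodule.Quotient.mk y ↔ (x : V) - y ∈ IQ I :=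
  Submodule.Quotient.eq _

lemma lat_le_Lstar : L.lat ≤ L.Lstar I := le_sup_left

lemma Istar_le_Lstar : L.Istar I ≤ L.Lstar I := le_sup_right

lemma Lstar_le_dual : L.Lstar I ≤ L.form.dualSubmodule L.lat := sup_le L.lat_le_dual inf_le_right

lemma dual_Lstar_le_dual :
    L.form.dualSubmodule (L.Lstar I) ≤ L.form.dualSubmodule L.lat := fun _ hx y hy =>
  hx y (L.lat_le_Lstar I hy)

variable {I} in
lemma mem_dual_Lstar_of_mem_perp {y : V} (hy : y ∈ L.form.dualSubmodule L.lat)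
    (hyp : y ∈ L.perp I) : y ∈ L.form.dualSubmodule (L.Lstar I) := by
  refine mem_dualSubmodule_iff.2 fun z hz => ?_
  obtain ⟨a, ha, b, hb, rfl⟩ := Submodule.mem_sup.1 hz
  rw [map_add, L.form_eq_zero_of_mem_perp I hyp hb.1, add_zero]
  exact mem_dualSubmodule_iff.1 hy a ha

instance isLattice_K : Submodule.IsLattice ℚ (L.K I) where
  fg := by
    refine Submodule.FG.map _ (Submodule.fg_of_fg_map_injective
      ((L.perp I).subtype.restrictScalars ℤ) Subtype.val_injective ?_)
    exact L.fg.of_le (Submodule.map_comap_le _ _)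
  span_eq_top := by
    rw [eq_top_iff]
    rintro z -
    obtain ⟨x, rfl⟩ := Submodule.Quotient.mk_surjective _ z
    obtain ⟨k, hk, hkx⟩ := exists_zsmul_mem L.lat (x : V)
    have hk' : (k : ℚ) ≠ 0 := Int.cast_ne_zero.2 hk
    have hmem : k • (Submodule.Quotient.mk x : L.KQ I) ∈ L.K I := ⟨k • x, hkx, rfl⟩
    rw [← Submodule.smul_mem_iff _ hk', Int.cast_smul_eq_zsmul]
    exact Submodule.subset_span hmem

section Overlattice

variable {L I} (hI : IQ I ≤ L.perp I)
include hI

lemma Lstar_le_dual_Lstar : L.Lstar I ≤ L.form.dualSubmodule (L.Lstar I) := by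
  refine sup_le (fun x hx => mem_dualSubmodule_iff.2 fun y hy => ?_) fun x hx =>
    L.mem_dual_Lstar_of_mem_perp hx.2 (hI hx.1)
  rw [L.symm.eq]
  exact mem_dualSubmodule_iff.1 (L.Lstar_le_dual I hy) x hx

lemma even_Lstar {t : V} (ht : t ∈ L.Lstar I) : ∃ m : ℤ, L.form t t = 2 * m := by
  obtain ⟨a, ha, b, hb, rfl⟩ := Submodule.mem_sup.1 ht
  obtain ⟨m, hm⟩ := L.even a ha
  obtain ⟨k, hk⟩ := mem_dualSubmodule_iff.1 hb.2 a ha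
  have hbb : L.form b b = 0 := hI hb.1 b hb.1
  have hab : L.form a b = k := by rw [L.symm.eq, hk]
  refine ⟨m + k, ?_⟩
  simp only [map_add, LinearMap.add_apply, hm, hk, hbb, hab]
  push_cast
  ring

lemma mk_mem_K_iff {y : V} (hy : y ∈ L.form.dualSubmodule L.lat) (hyp : y ∈ L.perp I) :
    (Submodule.Quotient.mk ⟨y, hyp⟩ : L.KQ I) ∈ L.K I ↔ y ∈ L.Lstar I := by
  constructor
  · rintro ⟨x, hx, hxy⟩
    have hsub : (x : V) - y ∈ L.Istar I :=
      ⟨(L.mk_eq_mk_iff I x ⟨y, hyp⟩).1 hxy, sub_mem (L.lat_le_dual hx) hy⟩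
    simpa using sub_mem (L.lat_le_Lstar I hx) (L.Istar_le_Lstar I hsub)
  · intro h
    obtain ⟨a, ha, b, hb, rfl⟩ := Submodule.mem_sup.1 h
    have hap : a ∈ L.perp I := by simpa using sub_mem hyp (hI hb.1)
    exact ⟨⟨a, hap⟩, ha, (L.mk_eq_mk_iff I _ _).2 (by simpa using hb.1)⟩

lemma exists_perp_representative {x : V} (hx : x ∈ L.form.dualSubmodule (L.Lstar I)) :
    ∃ y : L.perp I, (y : V) ∈ L.form.dualSubmodule (L.Lstar I) ∧ (y : V) - x ∈ L.Lstar I := by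
  have hdual := isLattice_dualSubmodule L.lat L.nondegenerate
  have : Submodule.IsLattice ℚ (L.Lstar I) :=
    .of_le_of_isLattice_of_fg ℚ (L.lat_le_Lstar I) (hdual.fg.of_le (L.Lstar_le_dual I))
  have := isLattice_dualSubmodule (L.Lstar I) L.nondegenerate
  obtain ⟨u, hu, hux⟩ := exists_mem_dualSubmodule_of_integral
    (N := L.form.dualSubmodule (L.Lstar I)) L.nondegenerate (IQ I) x fun y hy hyI =>
      mem_dualSubmodule_iff.1 hx y (L.Istar_le_Lstar I ⟨hyI, L.dual_Lstar_le_dual I hy⟩)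
  rw [dualSubmodule_dualSubmodule _ L.nondegenerate L.symm] at hu
  refine ⟨⟨x - u, fun y hy => ?_⟩, sub_mem hx (Lstar_le_dual_Lstar hI hu), ?_⟩
  · change L.form y (x - u) = 0
    rw [L.symm.eq, map_sub, LinearMap.sub_apply, hux y hy, sub_self]
  · simpa using neg_mem hu

variable [FiniteDimensional ℚ V]

lemma exists_lift_dual_K {z : L.KQ I} (hz : z ∈ (L.formK I).dualSubmodule (L.K I)) :
    ∃ y : L.perp I, (y : V) ∈ L.form.dualSubmodule (L.Lstar I) ∧ Submodule.Quotient.mk y = z := by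
  obtain ⟨x, rfl⟩ := Submodule.Quotient.mk_surjective _ z
  obtain ⟨u, hu, hux⟩ := exists_mem_dualSubmodule_of_integral (N := L.lat) L.nondegenerate
    (L.perp I) x fun y hy hyp => mem_dualSubmodule_iff.1 hz _ ⟨⟨y, hyp⟩, hy, rfl⟩
  have hsub : u - x ∈ IQ I := by
    rw [← LinearMap.BilinForm.orthogonal_orthogonal L.nondegenerate L.symm.isRefl (IQ I)]
    intro y hy
    change L.form y (u - x) = 0
    rw [L.symm.eq, map_sub, LinearMap.sub_apply, hux y hy, sub_self]
  have hup : u ∈ L.perp I := by simpa using add_mem (hI hsub) x.2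
  exact ⟨⟨u, hup⟩, L.mem_dual_Lstar_of_mem_perp hu hup, (L.mk_eq_mk_iff I _ _).2 hsub⟩

end Overlattice

section Signature

variable [FiniteDimensional ℚ V]

lemma sigPos_add_sigNeg : L.sigPos + L.sigNeg = finrank ℚ V := by
  have : Invertible (2 : ℚ) := invertibleOfNonzero two_ne_zero
  have hrad : (L.form.toQuadraticMap).radical = ⊥ := by
    rw [QuadraticMap.radical_eq_ker_associated,
      QuadraticMap.associated_left_inverse ℚ L.symm.eq]
    exact L.nondegenerate.ker_eq_bot
  have h := QuadraticForm.sigPos_add_sigNeg_add_radical (Q := L.form.toQuadraticMap)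
  rwa [hrad, finrank_bot, add_zero] at h

variable {L I} (hI : IQ I ≤ L.perp I) (hrank : finrank ℚ (IQ I) = L.sigPos)
include hI hrank

lemma form_neg_of_mem_perp {x : V} (hx : x ∈ L.perp I) (hxI : x ∉ IQ I) : L.form x x < 0 := by
  by_contra! hxx
  have hnonneg : ∀ w ∈ IQ I ⊔ Submodule.span ℚ {x}, (-L.form.toQuadraticMap) w ≤ 0 := by
    intro w hw
    obtain ⟨i, hi, y, hy, rfl⟩ := Submodule.mem_sup.1 hw
    obtain ⟨c, rfl⟩ := Submodule.mem_span_singleton.1 hy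
    have hii : L.form i i = 0 := hI hi i hi
    have hix : L.form i x = 0 := hx i hi
    have hxi : L.form x i = 0 := L.form_eq_zero_of_mem_perp I hx hi
    simp only [neg_apply, LinearMap.BilinMap.toQuadraticMap_apply, map_add, map_smul,
      LinearMap.add_apply, LinearMap.smul_apply, smul_eq_mul, hii, hix, hxi]
    nlinarith [mul_nonneg (mul_self_nonneg c) hxx]
  have hle := QuadraticForm.sigPos_add_finrank_le_of_nonpos hnonneg
  rw [Submodule.finrank_sup_span_singleton hxI, hrank, sigPos_neg,
    ← L.sigPos_add_sigNeg, sigNeg] at hle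
  omega

lemma posDef_neg_formK : (-L.formK I).toQuadraticMap.PosDef := by
  intro z hz
  obtain ⟨x, rfl⟩ := Submodule.Quotient.mk_surjective _ z
  exact neg_pos.2 (form_neg_of_mem_perp hI hrank x.2
    fun h => hz ((Submodule.Quotient.mk_eq_zero _).2 h))

lemma sigma_eq_neg_finrank : L.sigma = -(finrank ℚ (L.KQ I) : ℤ) := by
  have hquot : finrank ℚ (L.KQ I) + finrank ℚ ((IQ I).submoduleOf (L.perp I)) =
      finrank ℚ (L.perp I) := Submodule.finrank_quotient_add_finrank _
  have hperp : finrank ℚ (L.perp I) = finrank ℚ V - finrank ℚ (IQ I) :=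
    LinearMap.BilinForm.finrank_orthogonal L.nondegenerate (IQ I)
  rw [(Submodule.submoduleOfEquivOfLe hI).finrank_eq] at hquot
  have := L.sigPos_add_sigNeg
  rw [sigma]
  omega

end Signature

variable {L I} in
lemma IsMaximalIsotropic.finrank_IQ (hI : L.IsMaximalIsotropic I) :
    finrank ℚ (IQ I) = L.sigPos := by
  have : Module.IsTorsionFree ℤ V := .trans_faithfulSMul ℤ ℚ V
  have : Module.Finite ℤ I := Module.Finite.iff_fg.2 (L.fg.of_le hI.le)
  rw [Submodule.finrank_span_eq_finrank, hI.rank]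

end EvenLattice

lemma norm_e_ratCast_mul (r : ℚ) (τ : ℍ) :
    ‖e ((r : ℂ) * (τ : ℂ))‖ = Real.exp (-(2 * Real.pi * τ.im) * r) := by
  have him : ((r : ℂ) * (τ : ℂ)).im = r * τ.im := by
    rw [← Complex.ofReal_ratCast, Complex.im_ofReal_mul, UpperHalfPlane.coe_im]
  rw [norm_e, him]
  congr 1
  ring

namespace EvenLattice

variable {V : Type*} [AddCommGroup V] [Module ℚ V] (L : EvenLattice V) (I : Submodule ℤ V)

/-- The component `⟨e_a↓^L_K, Θ_{K⁺}⟩` at `a ∈ A_L` of the theta series of `K⁺` pulled back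
to `A_L`. -/
def thetaComponent (a : L.A) (τ : ℍ) : ℂ := L.contractTheta I τ (L.pushK I (Finsupp.single a 1))

/-- The coset of `K` in `K^∨` whose theta series is the component at `a ∈ A_L`. It consists of the
reductions modulo `I_ℚ` of the vectors of `(L^*)^∨ ∩ I_ℚ^⊥` congruent to `a` modulo `L^*`, and is
empty when `a ∉ (L^*)^∨/L`. -/
def thetaCoset (a : L.A) : Set (L.KQ I) :=
  {z | ∃ y : L.perp I, (y : V) ∈ L.form.dualSubmodule (L.Lstar I) ∧ (y : V) - rep a ∈ L.Lstar I ∧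
    Submodule.Quotient.mk y = z}

/-- The quadratic form `(z, z)/2` of `K⁺ = K(-1)`. -/
def halfNorm (z : L.KQ I) : ℚ := (-L.formK I) z z / 2

lemma halfNorm_mk (y : L.perp I) :
    L.halfNorm I (Submodule.Quotient.mk y) = -(L.form y y / 2) :=
  neg_div _ _

variable {I} in
lemma thetaComponent_of_mem {a : L.A} (ha : rep a ∈ L.form.dualSubmodule (L.Lstar I)) (τ : ℍ) :
    L.thetaComponent I a τ = theta (-L.formK I) (L.K I) τ
      (discNeg (L.formK I) (L.K I) (L.discIso I (cls L.form (L.Lstar I) (rep a) ha))) := by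
  rw [thetaComponent, pushK, LinearMap.comp_apply, pushforward, Finsupp.linearCombination_single,
    dif_pos ha, one_smul, Finsupp.lmapDomain_apply, Finsupp.mapDomain_single, contractTheta,
    Finsupp.linearCombination_single, one_smul]

variable {I} in
lemma thetaComponent_of_notMem {a : L.A} (ha : rep a ∉ L.form.dualSubmodule (L.Lstar I)) (τ : ℍ) :
    L.thetaComponent I a τ = 0 := by
  rw [thetaComponent, pushK, LinearMap.comp_apply, pushforward, Finsupp.linearCombination_single,
    dif_neg ha, smul_zero, map_zero, map_zero]

variable {L I} in
lemma mk_mem_thetaCoset_iff {a : L.A} {y : L.perp I}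
    (hy : (y : V) ∈ L.form.dualSubmodule (L.Lstar I)) :
    Submodule.Quotient.mk y ∈ L.thetaCoset I a ↔ rep a - y ∈ L.Lstar I := by
  constructor
  · rintro ⟨y', hy', hya', h⟩
    have hsub : (y' : V) - y ∈ L.Istar I :=
      ⟨(L.mk_eq_mk_iff I y' y).1 h, L.dual_Lstar_le_dual I (sub_mem hy' hy)⟩
    simpa using sub_mem (L.Istar_le_Lstar I hsub) hya'
  · exact fun h => ⟨y, hy, by simpa using neg_mem h, rfl⟩

section Isotropic

variable {L I} (hI : IQ I ≤ L.perp I)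
include hI

lemma rep_mem_dual_Lstar {a : L.A} {z : L.KQ I} (hz : z ∈ L.thetaCoset I a) :
    rep a ∈ L.form.dualSubmodule (L.Lstar I) := by
  obtain ⟨y, hy, hya, -⟩ := hz
  simpa using sub_mem hy (Lstar_le_dual_Lstar hI hya)

lemma mem_thetaCoset_iff {a : L.A} {y : L.perp I}
    (hy : (y : V) ∈ L.form.dualSubmodule (L.Lstar I)) (hya : (y : V) - rep a ∈ L.Lstar I)
    (z : L.KQ I) : z ∈ L.thetaCoset I a ↔ z - Submodule.Quotient.mk y ∈ L.K I := by
  constructor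
  · rintro ⟨y', hy', hya', rfl⟩
    rw [← Submodule.Quotient.mk_sub]
    refine (mk_mem_K_iff hI (L.dual_Lstar_le_dual I (sub_mem hy' hy)) (y' - y).2).2 ?_
    simpa using sub_mem hya' hya
  · rintro ⟨x, hx, hxz⟩
    have hx' := L.lat_le_Lstar I hx
    refine ⟨y + x, add_mem hy (Lstar_le_dual_Lstar hI hx'), ?_, ?_⟩
    · simpa [sub_add_eq_add_sub] using add_mem hya hx'
    · rw [Submodule.Quotient.mk_add, ← eq_sub_iff_add_eq']
      exact hxz

lemma discIso_cls (y : L.perp I) (hy : (y : V) ∈ L.form.dualSubmodule (L.Lstar I)) :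
    L.discIso I (cls L.form (L.Lstar I) y hy) =
      cls (L.formK I) (L.K I) (Submodule.Quotient.mk y) (L.mk_mem_dual_K I y hy) := by
  have h : ∃ (y' : L.perp I) (hy' : (y' : V) ∈ L.form.dualSubmodule (L.Lstar I)),
      cls L.form (L.Lstar I) y' hy' = cls L.form (L.Lstar I) y hy := ⟨y, hy, rfl⟩
  have hmem := h.choose_spec.choose
  have hsub := (cls_eq_cls_iff _ _).1 h.choose_spec.choose_spec
  rw [discIso, dif_pos h, cls_eq_cls_iff, ← Submodule.Quotient.mk_sub]
  exact (mk_mem_K_iff hI (L.dual_Lstar_le_dual I (sub_mem hmem hy)) (h.choose - y).2).2 hsub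

lemma exists_halfNorm_eq {a : L.A} {z : L.KQ I} (hz : z ∈ L.thetaCoset I a) :
    ∃ m : ℤ, L.halfNorm I z = -(L.form (rep a) (rep a) / 2) + m := by
  have ha := rep_mem_dual_Lstar hI hz
  obtain ⟨y, -, hya, rfl⟩ := hz
  obtain ⟨m, hm⟩ := even_Lstar hI hya
  obtain ⟨k, hk⟩ := mem_dualSubmodule_iff.1 ha _ hya
  rw [L.symm.eq] at hk
  have hk' := L.symm.eq y (rep a)
  refine ⟨-m - k, ?_⟩
  rw [halfNorm_mk]
  simp only [map_sub, LinearMap.sub_apply] at hm hk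
  push_cast
  linarith

lemma thetaComponent_eq_tsum (a : L.A) (τ : ℍ) :
    L.thetaComponent I a τ = ∑' z : (-L.formK I).dualSubmodule (L.K I),
      (L.thetaCoset I a).indicator (fun z => e ((L.halfNorm I z : ℂ) * (τ : ℂ))) z := by
  by_cases ha : rep a ∈ L.form.dualSubmodule (L.Lstar I)
  · obtain ⟨y, hy, hya⟩ := exists_perp_representative hI ha
    have hcls : cls L.form (L.Lstar I) (rep a) ha = cls L.form (L.Lstar I) y hy :=
      ((cls_eq_cls_iff hy ha).2 hya).symm
    rw [L.thetaComponent_of_mem ha, hcls, discIso_cls hI y hy, theta]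
    have hcoset : {z : (-L.formK I).dualSubmodule (L.K I) |
        (Submodule.Quotient.mk z : Disc (-L.formK I) (L.K I)) =
          discNeg (L.formK I) (L.K I) (cls (L.formK I) (L.K I) (Submodule.Quotient.mk y)
            (L.mk_mem_dual_K I y hy))} = Subtype.val ⁻¹' L.thetaCoset I a := by
      ext z
      exact (Submodule.Quotient.eq _).trans (mem_thetaCoset_iff hI hy hya z).symm
    refine (tsum_subtype {z : (-L.formK I).dualSubmodule (L.K I) | _} fun z =>
      e ((L.halfNorm I (z : L.KQ I) : ℂ) * (τ : ℂ))).trans ?_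
    rw [hcoset]
    exact tsum_congr fun z =>
      Set.indicator_comp_right (g := fun z => e ((L.halfNorm I z : ℂ) * (τ : ℂ))) _
  · rw [L.thetaComponent_of_notMem ha, eq_comm]
    convert tsum_zero with z
    exact Set.indicator_of_notMem (fun h => ha (rep_mem_dual_Lstar hI h)) _

lemma thetaComponent_eq_tsum_K {a : L.A} {y : L.perp I}
    (hy : (y : V) ∈ L.form.dualSubmodule (L.Lstar I)) (hya : (y : V) - rep a ∈ L.Lstar I) (τ : ℍ) :
    L.thetaComponent I a τ =
      ∑' k : L.K I, e ((L.halfNorm I ((Submodule.Quotient.mk y : L.KQ I) + k) : ℂ) * (τ : ℂ)) := by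
  have hcoset (k : L.K I) : Submodule.Quotient.mk y + (k : L.KQ I) ∈ L.thetaCoset I a :=
    (mem_thetaCoset_iff hI hy hya _).2 (by simp)
  have hdual (k : L.K I) :
      Submodule.Quotient.mk y + (k : L.KQ I) ∈ (-L.formK I).dualSubmodule (L.K I) := by
    obtain ⟨x, hx, -, hxk⟩ := hcoset k
    rw [neg_dualSubmodule, ← hxk]
    exact L.mk_mem_dual_K I x hx
  let g (k : L.K I) : (-L.formK I).dualSubmodule (L.K I) := ⟨_, hdual k⟩
  have hg : Function.Injective g := fun k k' h =>
    Subtype.ext (add_left_cancel (congrArg Subtype.val h))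
  rw [thetaComponent_eq_tsum hI, ← hg.tsum_eq]
  · exact tsum_congr fun k => Set.indicator_of_mem (hcoset k) _
  · intro z hz
    exact ⟨⟨_, (mem_thetaCoset_iff hI hy hya z).1 (Set.mem_of_indicator_ne_zero hz)⟩,
      Subtype.ext (by simp [g])⟩

lemma thetaComponent_vadd (a : L.A) (τ : ℍ) :
    L.thetaComponent I a ((1 : ℝ) +ᵥ τ) =
      e ((-(L.form (rep a) (rep a) / 2) : ℚ)) * L.thetaComponent I a τ := by
  rw [thetaComponent_eq_tsum hI, thetaComponent_eq_tsum hI, ← tsum_mul_left]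
  refine tsum_congr fun z => ?_
  by_cases hz : (z : L.KQ I) ∈ L.thetaCoset I a
  · obtain ⟨m, hm⟩ := exists_halfNorm_eq hI hz
    rw [Set.indicator_of_mem hz, Set.indicator_of_mem hz, UpperHalfPlane.coe_vadd, mul_add, e_add,
      Complex.ofReal_one, mul_one, e_ratCast_eq_of_sub m (sub_eq_iff_eq_add'.2 hm)]
  · rw [Set.indicator_of_notMem hz, Set.indicator_of_notMem hz, mul_zero]

end Isotropic

section PosDef

variable {L I} (hpos : (-L.formK I).toQuadraticMap.PosDef)
include hpos

lemma halfNorm_nonneg (z : L.KQ I) : 0 ≤ L.halfNorm I z :=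
  div_nonneg (hpos.nonneg z) zero_le_two

variable [FiniteDimensional ℚ V]

lemma summable_exp_neg_halfNorm {a : ℝ} (ha : 0 < a) :
    Summable fun z : (-L.formK I).dualSubmodule (L.K I) =>
      Real.exp (-a * (L.halfNorm I (z : L.KQ I) : ℚ)) := by
  have hsymm := (L.isSymm_formK I).neg
  have := isLattice_dualSubmodule (L.K I) (nondegenerate_of_posDef hsymm hpos)
  refine (summable_exp_neg_form (N := (-L.formK I).dualSubmodule (L.K I)) hsymm hpos 0
    (half_pos ha)).congr fun z => ?_
  rw [zero_add, halfNorm]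
  push_cast
  ring_nf

lemma summable_norm_indicator_thetaCoset (a : L.A) (τ : ℍ) :
    Summable fun z : (-L.formK I).dualSubmodule (L.K I) =>
      ‖(L.thetaCoset I a).indicator (fun z => e ((L.halfNorm I z : ℂ) * (τ : ℂ))) z‖ := by
  have ha : 0 < 2 * Real.pi * τ.im := by have := τ.im_pos; positivity
  refine .of_nonneg_of_le (fun _ => norm_nonneg _) (fun z => ?_)
    (summable_exp_neg_halfNorm hpos ha)
  rw [← norm_e_ratCast_mul]
  exact norm_indicator_le_norm_self (fun z => e ((L.halfNorm I z : ℂ) * (τ : ℂ))) z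

end PosDef

end EvenLattice

open Classical in
lemma sum_ite_coset {A : Type*} [AddCommGroup A] [Fintype A] (H : AddSubgroup A)
    (χ : AddChar A ℂ) (x : A) :
    ∑ a, (if a - x ∈ H then χ a else 0) =
      if ∀ h ∈ H, χ h = 1 then (Nat.card H : ℂ) * χ x else 0 := by
  have hχ : χ.compAddMonoidHom H.subtype = 0 ↔ ∀ h ∈ H, χ h = 1 := by
    simp [DFunLike.ext_iff]
  have hsum : ∑ h : H, χ h = if ∀ h ∈ H, χ h = 1 then (Nat.card H : ℂ) else 0 := by
    simpa [hχ, Nat.card_eq_fintype_card] using AddChar.sum_eq_ite (χ.compAddMonoidHom H.subtype)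
  rw [← ite_zero_mul, ← hsum, Finset.sum_mul, ← Equiv.sum_comp (Equiv.addRight x)]
  simp only [Equiv.coe_addRight, add_sub_cancel_right, AddChar.map_add_eq_mul]
  rw [← Finset.sum_filter, Finset.sum_subtype (p := (· ∈ H)) _ (by simp)]

section Overlattice

variable {V : Type*} [AddCommGroup V] [Module ℚ V] {B : LinearMap.BilinForm ℚ V}

/-- The subgroup `N'/N` of `A_N` for an overlattice `N ⊆ N' ⊆ N^∨`. -/
def discSub (B : LinearMap.BilinForm ℚ V) (N N' : Submodule ℤ V) : Submodule ℤ (Disc B N) :=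
  (N'.submoduleOf (B.dualSubmodule N)).map (N.submoduleOf (B.dualSubmodule N)).mkQ

variable {N N' : Submodule ℤ V} (hle : N ≤ N')
include hle

lemma cls_mem_discSub_iff {x : V} (hx : x ∈ B.dualSubmodule N) :
    cls B N x hx ∈ discSub B N N' ↔ x ∈ N' := by
  constructor
  · rintro ⟨y, hy, hyx⟩
    have hsub : (y : V) - x ∈ N' := hle ((cls_eq_cls_iff y.2 hx).1 hyx)
    have hy' : (y : V) ∈ N' := hy
    simpa using sub_mem hy' hsub
  · exact fun h => ⟨⟨x, hx⟩, h, rfl⟩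

lemma sub_cls_mem_discSub_iff {x : V} (hx : x ∈ B.dualSubmodule N) (a : Disc B N) :
    a - cls B N x hx ∈ discSub B N N' ↔ rep a - x ∈ N' := by
  rw [← cls_mem_discSub_iff hle (sub_mem (rep_mem a) hx)]
  conv_lhs => rw [← cls_rep a]
  rfl

lemma discChar_eq_one_on_discSub_iff (hle' : N' ≤ B.dualSubmodule N) {μ : V}
    (hμ : μ ∈ B.dualSubmodule N) :
    (∀ a ∈ discSub B N N', discChar hμ a = 1) ↔ μ ∈ B.dualSubmodule N' := by
  simp only [mem_dualSubmodule_iff (N := N'), ← e_ratCast_eq_one_iff]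
  constructor
  · intro h y hy
    rw [← discChar_cls hμ (hle' hy)]
    exact h _ ((cls_mem_discSub_iff hle (hle' hy)).2 hy)
  · rintro h _ ⟨y, hy, rfl⟩
    exact (discChar_cls hμ y.2).trans (h y hy)

end Overlattice

lemma coe_S_smul (τ : ℍ) : ((ModularGroup.S • τ : ℍ) : ℂ) = -1 / (τ : ℂ) := by
  rw [UpperHalfPlane.modular_S_smul, UpperHalfPlane.coe_mk, inv_neg, neg_div, one_div]

namespace EvenLattice

variable {V : Type*} [AddCommGroup V] [Module ℚ V] {L : EvenLattice V} {I : Submodule ℤ V}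

open Classical in
lemma sum_ite_mem_thetaCoset [Fintype L.A] (l : L.A) {x : L.perp I}
    (hx : (x : V) ∈ L.form.dualSubmodule (L.Lstar I)) :
    ∑ a : L.A, (if Submodule.Quotient.mk x ∈ L.thetaCoset I a then
        e (-(L.form (rep l) (rep a) : ℚ)) else 0) =
      if rep l ∈ L.form.dualSubmodule (L.Lstar I) then
        (Nat.card (discSub L.form L.lat (L.Lstar I)) : ℂ) * e (-(L.form (rep l) x : ℚ)) else 0 := by
  have hx' := L.dual_Lstar_le_dual I hx
  have hl := neg_mem (rep_mem l)
  have hsum := sum_ite_coset (discSub L.form L.lat (L.Lstar I)).toAddSubgroup (discChar hl)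
    (cls L.form L.lat x hx')
  simp only [Submodule.mem_toAddSubgroup, sub_cls_mem_discSub_iff (L.lat_le_Lstar I) hx',
    discChar_eq_one_on_discSub_iff (L.lat_le_Lstar I) (L.Lstar_le_dual I) hl, neg_mem_iff,
    discChar_cls hl hx', ← mk_mem_thetaCoset_iff hx] at hsum
  simpa only [discChar_apply, map_neg, LinearMap.neg_apply, Rat.cast_neg] using hsum

lemma e_neg_form_rep_eq {l : L.A} {x y : L.perp I}
    (hx : (x : V) ∈ L.form.dualSubmodule (L.Lstar I)) (hyl : (y : V) - rep l ∈ L.Lstar I) :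
    e (-(L.form (rep l) x : ℚ)) =
      e ((-L.formK I) (Submodule.Quotient.mk y) (Submodule.Quotient.mk x) : ℚ) := by
  obtain ⟨m, hm⟩ := mem_dualSubmodule_iff.1 hx _ hyl
  rw [L.symm.eq, map_sub, LinearMap.sub_apply] at hm
  rw [← Rat.cast_neg, LinearMap.neg_apply, LinearMap.neg_apply, formK_mk]
  exact e_ratCast_eq_of_sub m (by rw [← hm]; ring)

variable [FiniteDimensional ℚ V] (hI : IQ I ≤ L.perp I)
  (hpos : (-L.formK I).toQuadraticMap.PosDef)
include hI hpos

open Classical in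
lemma sum_mul_thetaComponent [Fintype L.A] (c : L.A → ℂ) (τ : ℍ) :
    ∑ a, c a * L.thetaComponent I a τ = ∑' z : (-L.formK I).dualSubmodule (L.K I),
      e ((L.halfNorm I z : ℂ) * (τ : ℂ)) *
        ∑ a, if (z : L.KQ I) ∈ L.thetaCoset I a then c a else 0 := by
  simp_rw [thetaComponent_eq_tsum hI, ← tsum_mul_left]
  rw [← Summable.tsum_finsetSum fun a _ =>
    (summable_norm_indicator_thetaCoset hpos a τ).of_norm.mul_left _]
  refine tsum_congr fun z => ?_
  rw [Finset.mul_sum]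
  exact Finset.sum_congr rfl fun a _ => by
    rw [Set.indicator_apply, mul_ite_zero, mul_ite_zero, mul_comm]

lemma exists_sum_thetaComponent_S [Fintype L.A] : ∃ c : ℝ, 0 < c ∧ ∀ (τ : ℍ) (l : L.A),
    ∑ a : L.A, e (-(L.form (rep l) (rep a) : ℚ)) * L.thetaComponent I a (ModularGroup.S • τ) =
      c * (-Complex.I * τ) ^ (finrank ℚ (L.KQ I) / 2 : ℂ) * L.thetaComponent I l τ := by
  classical
  have hsymm := (L.isSymm_formK I).neg
  obtain ⟨c, hc, hinv⟩ := exists_theta_inversion (N := L.K I) hsymm hpos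
  let H := discSub L.form L.lat (L.Lstar I)
  refine ⟨Nat.card H * c, mul_pos (by exact_mod_cast Nat.card_pos) hc, fun τ l => ?_⟩
  rw [sum_mul_thetaComponent hI hpos]
  have hlift (z : (-L.formK I).dualSubmodule (L.K I)) := exists_lift_dual_K hI
    ((neg_dualSubmodule (L.formK I) (L.K I)).le z.2)
  by_cases hl : rep l ∈ L.form.dualSubmodule (L.Lstar I)
  · obtain ⟨y, hy, hyl⟩ := exists_perp_representative hI hl
    have hterm (z : (-L.formK I).dualSubmodule (L.K I)) :
        (∑ a : L.A, if (z : L.KQ I) ∈ L.thetaCoset I a then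
          e (-(L.form (rep l) (rep a) : ℚ)) else 0) =
        Nat.card H * e ((-L.formK I) (Submodule.Quotient.mk y) z : ℚ) := by
      obtain ⟨x, hx, hxz⟩ := hlift z
      rw [← hxz, sum_ite_mem_thetaCoset l hx, if_pos hl, e_neg_form_rep_eq hx hyl]
    simp_rw [hterm, coe_S_smul, mul_left_comm _ (Nat.card H : ℂ)]
    rw [tsum_mul_left, thetaComponent_eq_tsum_K hI hy hyl, Complex.ofReal_mul,
      Complex.ofReal_natCast, mul_assoc (Nat.card H : ℂ), mul_assoc (Nat.card H : ℂ)]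
    exact congrArg _ (hinv τ (Submodule.Quotient.mk y))
  · rw [L.thetaComponent_of_notMem hl, mul_zero]
    convert tsum_zero with z
    obtain ⟨x, hx, hxz⟩ := hlift z
    rw [← hxz, sum_ite_mem_thetaCoset l hx, if_neg hl, mul_zero]

end EvenLattice

section WeilOperators

variable {V : Type*} [AddCommGroup V] [Module ℚ V] {B : LinearMap.BilinForm ℚ V}
  {N : Submodule ℤ V}

lemma weilT_apply [Finite (Disc B N)] (v : Disc B N →₀ ℂ) (b : Disc B N) :
    weilT B N v b = e ((B (rep b) (rep b) / 2 : ℚ)) * v b := by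
  classical
  cases nonempty_fintype (Disc B N)
  rw [weilT, Finsupp.linearCombination_apply, Finsupp.sum_fintype _ _ (by simp)]
  simp [Finsupp.finsetSum_apply, Finsupp.single_apply, mul_comm]

variable [Fintype (Disc B N)]

lemma weilS_apply (σ : ℤ) (v : Disc B N →₀ ℂ) (b : Disc B N) :
    weilS B N σ v b = (e (-(σ : ℂ) / 8) / (Real.sqrt (Nat.card (Disc B N)) : ℂ)) *
      ∑ a, v a * e (-(B (rep a) (rep b) : ℚ)) := by
  classical
  rw [weilS, Finsupp.linearCombination_apply, Finsupp.sum_fintype _ _ (by simp), Finset.mul_sum]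
  simp [Finsupp.finsetSum_apply, finsum_eq_sum_of_fintype, Finsupp.single_apply, mul_left_comm]

lemma sum_e_neg_rep_zero_mul (hs : B.IsSymm) (v : Disc B N → ℂ) :
    ∑ a, e (-(B (rep (0 : Disc B N)) (rep a) : ℚ)) * v a = ∑ a, v a := by
  refine Finset.sum_congr rfl fun a _ => ?_
  obtain ⟨m, hm⟩ := mem_dualSubmodule_iff.1 (rep_mem a) _ ((rep_mem_iff (0 : Disc B N)).2 rfl)
  rw [hs.eq, hm, ← Rat.cast_neg, e_ratCast_eq_one_iff.2 ⟨-m, (Int.cast_neg m).symm⟩, one_mul]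

lemma sum_sum_e_neg_rep_mul [Submodule.IsLattice ℚ N] (hB : B.Nondegenerate) (hs : B.IsSymm)
    (v : Disc B N → ℂ) :
    ∑ l : Disc B N, ∑ a : Disc B N, e (-(B (rep l) (rep a) : ℚ)) * v a =
      (Nat.card (Disc B N) : ℂ) * v 0 := by
  classical
  have hsum (a : Disc B N) : ∑ l : Disc B N, e (-(B (rep l) (rep a) : ℚ)) =
      if a = 0 then (Nat.card (Disc B N) : ℂ) else 0 := by
    have h := sum_e_rep hB hs (neg_mem (rep_mem a) : -rep a ∈ B.dualSubmodule N)
    simp only [map_neg, LinearMap.neg_apply, Rat.cast_neg, neg_mem_iff, rep_mem_iff] at h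
    simp only [hs.eq _ (rep a), h, Nat.card_eq_fintype_card]
  rw [Finset.sum_comm]
  simp [← Finset.sum_mul, hsum]

end WeilOperators

lemma neg_I_mul_cpow_half (τ : ℍ) (n : ℕ) :
    (-Complex.I * τ : ℂ) ^ (n / 2 : ℂ) = (e (-1 / 8) * (τ : ℂ) ^ (1 / 2 : ℂ)) ^ n := by
  have hI0 : -Complex.I ≠ 0 := neg_ne_zero.2 Complex.I_ne_zero
  have harg := Complex.arg_nonneg_iff.2 (show 0 ≤ (τ : ℂ).im from τ.im_pos.le)
  have harg' := Complex.arg_le_pi (τ : ℂ)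
  have hlog : Complex.log (-Complex.I * τ) = Complex.log (-Complex.I) + Complex.log τ :=
    Complex.log_mul hI0 τ.ne_zero (by
      rw [Complex.arg_neg_I]
      constructor <;> linarith [Real.pi_pos])
  rw [Complex.cpow_def_of_ne_zero (mul_ne_zero hI0 τ.ne_zero),
    Complex.cpow_def_of_ne_zero τ.ne_zero, e, ← Complex.exp_add, ← Complex.exp_nat_mul, hlog,
    Complex.log_neg_I]
  congr 1
  ring

lemma cpow_half_zpow_mul_neg_I_mul_cpow (τ : ℍ) (n : ℕ) :
    ((τ : ℂ) ^ (1 / 2 : ℂ)) ^ (-n : ℤ) * e (n / 8) * (-Complex.I * τ : ℂ) ^ (n / 2 : ℂ) = 1 := by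
  have hτ : (τ : ℂ) ^ (1 / 2 : ℂ) ≠ 0 := Mp2Z.S.phi_ne_zero τ
  have he : e (n / 8) * e (-1 / 8) ^ n = 1 := by
    rw [e, e, ← Complex.exp_nat_mul, ← Complex.exp_add, Complex.exp_eq_one_iff]
    exact ⟨0, by push_cast; ring⟩
  rw [neg_I_mul_cpow_half, mul_pow, zpow_neg, zpow_natCast, ← mul_assoc, mul_assoc _ (e _), he,
    mul_one, inv_mul_cancel₀ (pow_ne_zero n hτ)]

namespace EvenLattice

variable {V : Type*} [AddCommGroup V] [Module ℚ V] {L : EvenLattice V} {I : Submodule ℤ V}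

lemma xi_eq_sum [Fintype L.A] (f : ℍ → (L.A →₀ ℂ)) (τ : ℍ) :
    L.xi I f τ = ∑ a : L.A, f τ a * L.thetaComponent I a τ := by
  have hf : f τ = ∑ a : L.A, f τ a • Finsupp.single a (1 : ℂ) :=
    ((f τ).sum_single.symm.trans (Finsupp.sum_fintype _ _ (by simp))).trans (by simp)
  rw [xi]
  conv_lhs => rw [hf]
  simp only [map_sum, map_smul, smul_eq_mul]
  rfl

instance finite_A : Finite L.A := finite_disc L.lat L.nondegenerate

variable (hI : IQ I ≤ L.perp I)

section ThetaInversion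

variable [FiniteDimensional ℚ V] (hpos : (-L.formK I).toQuadraticMap.PosDef)
include hI hpos

lemma thetaComponent_zero_I_ne_zero : L.thetaComponent I 0 UpperHalfPlane.I ≠ 0 := by
  have h0 : ((0 : L.perp I) : V) - rep (0 : L.A) ∈ L.Lstar I := by
    rw [Submodule.coe_zero, zero_sub]
    exact neg_mem (L.lat_le_Lstar I ((rep_mem_iff 0).2 rfl))
  have hterm (z : L.KQ I) : e ((L.halfNorm I z : ℂ) * (UpperHalfPlane.I : ℍ)) =
      (Real.exp (-Real.pi * ((-L.formK I) z z : ℚ)) : ℝ) := by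
    rw [e, Complex.ofReal_exp, UpperHalfPlane.coe_I, halfNorm]
    congr 1
    push_cast
    linear_combination (Real.pi * ((-L.formK I) z z : ℚ) : ℂ) * Complex.I_sq
  rw [thetaComponent_eq_tsum_K hI (zero_mem _) h0]
  simp_rw [hterm]
  rw [← Complex.ofReal_tsum, Complex.ofReal_ne_zero]
  exact ((summable_exp_neg_form (N := L.K I) (L.isSymm_formK I).neg hpos _ Real.pi_pos).tsum_pos
    (fun _ => (Real.exp_pos _).le) 0 (Real.exp_pos _)).ne'

lemma sum_thetaComponent_S [Fintype L.A] (τ : ℍ) (l : L.A) :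
    ∑ a : L.A, e (-(L.form (rep l) (rep a) : ℚ)) * L.thetaComponent I a (ModularGroup.S • τ) =
      Real.sqrt (Nat.card L.A) * (-Complex.I * τ) ^ (finrank ℚ (L.KQ I) / 2 : ℂ) *
        L.thetaComponent I l τ := by
  obtain ⟨c, hc, h⟩ := exists_sum_thetaComponent_S hI hpos
  -- At the fixed point `i` of `S` the theta components are an eigenvector for the eigenvalue `c`.
  let v (a : L.A) : ℂ := L.thetaComponent I a UpperHalfPlane.I
  have hv (l : L.A) : ∑ a : L.A, e (-(L.form (rep l) (rep a) : ℚ)) * v a = c * v l := by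
    have hS : ModularGroup.S • UpperHalfPlane.I = UpperHalfPlane.I :=
      UpperHalfPlane.ext (by rw [coe_S_smul, UpperHalfPlane.coe_I]; simp)
    have h' := h UpperHalfPlane.I l
    rw [hS] at h'
    simpa [UpperHalfPlane.coe_I] using h'
  have hsq : (c * c : ℂ) * v 0 = Nat.card L.A * v 0 :=
    calc (c * c : ℂ) * v 0 = c * ∑ a, v a := by
          rw [mul_assoc, ← hv, sum_e_neg_rep_zero_mul L.symm]
      _ = ∑ l, ∑ a, e (-(L.form (rep l) (rep a) : ℚ)) * v a := by
          rw [Finset.mul_sum]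
          exact Finset.sum_congr rfl fun l _ => (hv l).symm
      _ = Nat.card L.A * v 0 := sum_sum_e_neg_rep_mul L.nondegenerate L.symm v
  have hcard : c * c = Nat.card L.A := by
    exact_mod_cast mul_right_cancel₀ (thetaComponent_zero_I_ne_zero hI hpos) hsq
  rw [← hcard, Real.sqrt_mul_self hc.le]
  exact h τ l

end ThetaInversion

section Invariance

variable {f : ℍ → (L.A →₀ ℂ)} (hf : f ∈ L.forms)
include hI hf

lemma xi_vadd (τ : ℍ) : L.xi I f ((1 : ℝ) +ᵥ τ) = L.xi I f τ := by
  cases nonempty_fintype L.A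
  have hT : f ((1 : ℝ) +ᵥ τ) = weilT L.form L.lat (f τ) := by
    have h := hf.modular Mp2Z.T (weilT L.form L.lat) (Submonoid.subset_closure (by simp)) τ
    rwa [Mp2Z.T, UpperHalfPlane.modular_T_smul, one_zpow, one_smul] at h
  rw [xi_eq_sum, xi_eq_sum, hT]
  refine Finset.sum_congr rfl fun a _ => ?_
  have hphase : e ((L.form (rep a) (rep a) / 2 : ℚ)) *
      e ((-(L.form (rep a) (rep a) / 2) : ℚ)) = 1 := by
    rw [← e_add, Rat.cast_neg, add_neg_cancel, e_zero]
  rw [weilT_apply, thetaComponent_vadd hI]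
  linear_combination (f τ a * L.thetaComponent I a τ) * hphase

variable [FiniteDimensional ℚ V] (hrank : finrank ℚ (IQ I) = L.sigPos)
include hrank

lemma xi_S (τ : ℍ) : L.xi I f (ModularGroup.S • τ) = L.xi I f τ := by
  cases nonempty_fintype L.A
  let t : ℂ := ((τ : ℂ) ^ (1 / 2 : ℂ)) ^ L.sigma
  let s : ℂ := (Real.sqrt (Nat.card L.A) : ℂ)
  have hs : s ≠ 0 := Complex.ofReal_ne_zero.2
    (Real.sqrt_pos.2 (by exact_mod_cast Nat.card_pos)).ne'
  have hS : f (ModularGroup.S • τ) = t • weilS L.form L.lat L.sigma (f τ) :=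
    hf.modular Mp2Z.S _ (Submonoid.subset_closure (by simp)) τ
  have hfactor : t * e (-(L.sigma : ℂ) / 8) *
      (-Complex.I * τ) ^ (finrank ℚ (L.KQ I) / 2 : ℂ) = 1 := by
    simpa [t, sigma_eq_neg_finrank hI hrank] using
      cpow_half_zpow_mul_neg_I_mul_cpow τ (finrank ℚ (L.KQ I))
  calc L.xi I f (ModularGroup.S • τ)
      = t * (e (-(L.sigma : ℂ) / 8) / s) * ∑ a : L.A, f τ a *
          ∑ b : L.A, e (-(L.form (rep a) (rep b) : ℚ)) *
            L.thetaComponent I b (ModularGroup.S • τ) := by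
        rw [xi_eq_sum, hS]
        simp only [Finsupp.smul_apply, weilS_apply, smul_eq_mul, Finset.mul_sum, Finset.sum_mul]
        rw [Finset.sum_comm]
        exact Finset.sum_congr rfl fun a _ => Finset.sum_congr rfl fun b _ => by ring
    _ = t * e (-(L.sigma : ℂ) / 8) * (-Complex.I * τ) ^ (finrank ℚ (L.KQ I) / 2 : ℂ) *
          (s⁻¹ * s) * ∑ a : L.A, f τ a * L.thetaComponent I a τ := by
        simp_rw [sum_thetaComponent_S hI (posDef_neg_formK hI hrank), Finset.mul_sum]
        exact Finset.sum_congr rfl fun a _ => by ring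
    _ = L.xi I f τ := by rw [hfactor, inv_mul_cancel₀ hs, one_mul, one_mul, xi_eq_sum]

lemma xi_smul_of_mem_weilGraph {x : Mp2Z × Module.End ℂ (L.A →₀ ℂ)}
    (hx : x ∈ weilGraph L.form L.lat L.sigma) (τ : ℍ) :
    L.xi I f (x.1.mat • τ) = L.xi I f τ := by
  induction hx using Submonoid.closure_induction generalizing τ with
  | mem x hx =>
    rcases hx with rfl | rfl
    · exact (congrArg (L.xi I f) (UpperHalfPlane.modular_T_smul τ)).trans (xi_vadd hI hf τ)
    · exact xi_S hI hf hrank τ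
  | one => exact congrArg _ (one_smul _ τ)
  | mul x y _ _ hx hy => rw [Prod.fst_mul, Mp2Z.mul_mat, mul_smul, hx, hy]

end Invariance

end EvenLattice

section QExpansion

/-- The `q`-expansion `g = ∑_{n ∈ r + ℤ} c(n) q^n` of a function on the upper half plane, with
coefficients in the subring `S ⊆ ℂ` that vanish for `n` small enough. As for
`HasFourierExpansion`, the coefficients are indexed by all `n ∈ ℚ`. -/
structure HasQExpansion (S : Subring ℂ) (r : ℚ) (g : ℍ → ℂ) (c : ℚ → ℂ) : Prop where
  coeff_mem : ∀ n, c n ∈ S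
  support : ∀ n, c n ≠ 0 → ∃ m : ℤ, n = r + m
  bddBelow : ∃ n₀ : ℚ, ∀ n < n₀, c n = 0
  hasSum : ∀ τ : ℍ, HasSum (fun n : ℚ => c n * e ((n : ℂ) * τ)) (g τ)

lemma finite_setOf_eq_add_intCast_mem_Icc (r a b : ℚ) :
    {x : ℚ | (∃ m : ℤ, x = r + m) ∧ x ∈ Set.Icc a b}.Finite := by
  refine ((Set.finite_Icc ⌈a - r⌉ ⌊b - r⌋).image fun m : ℤ => r + (m : ℚ)).subset ?_
  rintro _ ⟨⟨m, rfl⟩, ha, hb⟩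
  exact ⟨m, ⟨Int.ceil_le.2 (by linarith), Int.le_floor.2 (by linarith)⟩, rfl⟩

lemma norm_e_ratCast_mul_le {n₀ n : ℚ} (hn : n₀ ≤ n) {τ z : ℍ} (hτz : τ.im ≤ z.im) {y : ℝ}
    (hzy : z.im ≤ y) :
    ‖e ((n : ℂ) * z)‖ ≤ ‖e ((n : ℂ) * τ)‖ * Real.exp (2 * Real.pi * y * |(n₀ : ℝ)|) := by
  rw [norm_e_ratCast_mul, norm_e_ratCast_mul, ← Real.exp_add, Real.exp_le_exp]
  have hn' : -|(n₀ : ℝ)| ≤ n := (neg_abs_le _).trans (by exact_mod_cast hn)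
  have h : -(z.im - τ.im) * n ≤ y * |(n₀ : ℝ)| :=
    calc -(z.im - τ.im) * n ≤ (z.im - τ.im) * |(n₀ : ℝ)| := by
          nlinarith [mul_le_mul_of_nonneg_left hn' (sub_nonneg.2 hτz)]
      _ ≤ y * |(n₀ : ℝ)| :=
          mul_le_mul_of_nonneg_right (by linarith [τ.im_pos]) (abs_nonneg _)
  nlinarith [mul_le_mul_of_nonneg_left h Real.two_pi_pos.le]

variable {S : Subring ℂ} {r : ℚ} {g : ℍ → ℂ}

lemma exists_hasQExpansion_of_hasSum {Z : Type*} {b : Z → ℂ} {ν : Z → ℚ} (hb : ∀ z, b z ∈ S)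
    (hν : ∀ z, b z ≠ 0 → ∃ m : ℤ, ν z = r + m) {n₀ : ℚ} (hn₀ : ∀ z, b z ≠ 0 → n₀ ≤ ν z)
    (hfin : ∀ n, {z | ν z = n ∧ b z ≠ 0}.Finite)
    (hsum : ∀ τ : ℍ, HasSum (fun z => b z * e ((ν z : ℂ) * τ)) (g τ)) :
    ∃ c, HasQExpansion S r g c := by
  have hne {n : ℚ} (h : ∑ᶠ z : {z // ν z = n}, b z ≠ 0) : ∃ z, ν z = n ∧ b z ≠ 0 := by
    by_contra! hz
    exact h (finsum_eq_zero_of_forall_eq_zero fun z => hz z z.2)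
  refine ⟨fun n => ∑ᶠ z : {z // ν z = n}, b z, fun n => ?_, fun n hn => ?_,
    ⟨n₀, fun n hn => ?_⟩, fun τ => ?_⟩
  · exact finsum_induction (· ∈ S) (zero_mem S) (fun _ _ => add_mem) fun z => hb z
  · obtain ⟨z, rfl, hz⟩ := hne hn
    exact hν z hz
  · by_contra h
    obtain ⟨z, rfl, hz⟩ := hne h
    exact hn.not_ge (hn₀ z hz)
  · refine HasSum.sigma ((Equiv.sigmaFiberEquiv ν).hasSum_iff.2 (hsum τ)) fun n => ?_
    have hsupp : (Function.support fun z : {z // ν z = n} => b z).Finite :=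
      Set.Finite.of_finite_image ((hfin n).subset (by rintro _ ⟨z, hz, rfl⟩; exact ⟨z.2, hz⟩))
        Subtype.val_injective.injOn
    have h : HasSum (fun z : {z // ν z = n} => b z) (∑ᶠ z : {z // ν z = n}, b z) := by
      rw [← tsum_eq_finsum (L := .unconditional _) hsupp]
      exact (summable_of_hasFiniteSupport hsupp).hasSum
    exact (h.mul_right (e ((n : ℂ) * τ))).congr_fun fun z =>
      congrArg (fun m : ℚ => b z * e ((m : ℂ) * τ)) z.2

namespace HasQExpansion

lemma zero : HasQExpansion S r 0 0 :=
  ⟨fun _ => zero_mem S, fun _ h => absurd rfl h, ⟨0, fun _ _ => rfl⟩, fun τ => by simp⟩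

variable {h : ℍ → ℂ} {c d : ℚ → ℂ}

lemma neg (hg : HasQExpansion S r g c) : HasQExpansion S r (-g) (-c) where
  coeff_mem n := neg_mem (hg.coeff_mem n)
  support n hn := hg.support n (neg_ne_zero.1 hn)
  bddBelow := hg.bddBelow.imp fun _ h n hn => neg_eq_zero.2 (h n hn)
  hasSum τ := by simpa using (hg.hasSum τ).neg

lemma add (hg : HasQExpansion S r g c) (hh : HasQExpansion S r h d) :
    HasQExpansion S r (g + h) (c + d) where
  coeff_mem n := add_mem (hg.coeff_mem n) (hh.coeff_mem n)
  support n hn := by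
    by_cases hc : c n = 0
    · exact hh.support n fun hd => hn (by simp [hc, hd])
    · exact hg.support n hc
  bddBelow := by
    obtain ⟨m, hm⟩ := hg.bddBelow
    obtain ⟨n, hn⟩ := hh.bddBelow
    exact ⟨min m n, fun k hk => by
      simp [hm k (hk.trans_le (min_le_left _ _)), hn k (hk.trans_le (min_le_right _ _))]⟩
  hasSum τ := by simpa [add_mul] using (hg.hasSum τ).add (hh.hasSum τ)

lemma sum {ι : Type*} (t : Finset ι) {g : ι → ℍ → ℂ} {c : ι → ℚ → ℂ}
    (hg : ∀ i ∈ t, HasQExpansion S r (g i) (c i)) :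
    HasQExpansion S r (∑ i ∈ t, g i) (∑ i ∈ t, c i) := by
  classical
  induction t using Finset.induction_on with
  | empty => exact zero
  | insert i t hi ih =>
    rw [Finset.sum_insert hi, Finset.sum_insert hi]
    exact (hg i (Finset.mem_insert_self i t)).add
      (ih fun j hj => hg j (Finset.mem_insert_of_mem hj))

lemma exists_mul {s : ℚ} (hg : HasQExpansion S r g c) (hh : HasQExpansion S s h d) :
    ∃ c', HasQExpansion S (r + s) (g * h) c' := by
  obtain ⟨m₀, hm₀⟩ := hg.bddBelow
  obtain ⟨n₀, hn₀⟩ := hh.bddBelow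
  have hle {z : ℚ × ℚ} (hz : c z.1 * d z.2 ≠ 0) : m₀ ≤ z.1 ∧ n₀ ≤ z.2 :=
    ⟨not_lt.1 fun h => left_ne_zero_of_mul hz (hm₀ _ h),
      not_lt.1 fun h => right_ne_zero_of_mul hz (hn₀ _ h)⟩
  refine exists_hasQExpansion_of_hasSum (b := fun z : ℚ × ℚ => c z.1 * d z.2)
    (ν := fun z => z.1 + z.2) (fun z => mul_mem (hg.coeff_mem _) (hh.coeff_mem _))
    (fun z hz => ?_) (fun z hz => add_le_add (hle hz).1 (hle hz).2) (fun n => ?_) fun τ => ?_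
  · obtain ⟨m, hm⟩ := hg.support _ (left_ne_zero_of_mul hz)
    obtain ⟨k, hk⟩ := hh.support _ (right_ne_zero_of_mul hz)
    exact ⟨m + k, by rw [hm, hk]; push_cast; ring⟩
  · refine Set.Finite.of_finite_image (f := Prod.fst)
      ((finite_setOf_eq_add_intCast_mem_Icc r m₀ (n - n₀)).subset ?_) ?_
    · rintro _ ⟨z, ⟨rfl, hz⟩, rfl⟩
      exact ⟨hg.support _ (left_ne_zero_of_mul hz), (hle hz).1, by linarith [(hle hz).2]⟩
    · rintro z ⟨hz, -⟩ w ⟨hw, -⟩ hzw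
      exact Prod.ext hzw (by linarith)
  · have hprod : Summable fun z : ℚ × ℚ =>
        c z.1 * e ((z.1 : ℂ) * τ) * (d z.2 * e ((z.2 : ℂ) * τ)) :=
      summable_mul_of_summable_norm (f := fun n : ℚ => c n * e ((n : ℂ) * τ))
        (g := fun n : ℚ => d n * e ((n : ℂ) * τ))
        (hg.hasSum τ).summable.norm (hh.hasSum τ).summable.norm
    refine ((hg.hasSum τ).mul (hh.hasSum τ) hprod).congr_fun fun z => ?_
    rw [mul_mul_mul_comm, ← e_add, Rat.cast_add, add_mul]

lemma mdifferentiable (hg : HasQExpansion S r g c) : MDiff g := by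
  obtain ⟨n₀, hn₀⟩ := hg.bddBelow
  rw [UpperHalfPlane.mdifferentiable_iff]
  intro w (hw : 0 < w.im)
  let τ : ℍ := ⟨(w.im / 2 : ℝ) * Complex.I, by simpa using hw⟩
  let U : Set ℂ := {z | w.im / 2 < z.im ∧ z.im < w.im + 1}
  have hU : IsOpen U := (isOpen_lt continuous_const Complex.continuous_im).inter
    (isOpen_lt Complex.continuous_im continuous_const)
  have hwU : w ∈ U := ⟨half_lt_self hw, lt_add_one _⟩
  have hpos {z : ℂ} (hz : z ∈ U) : 0 < z.im := (half_pos hw).trans hz.1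
  have hτ : τ.im = w.im / 2 := by simp [τ, UpperHalfPlane.im]
  have hbound (n : ℚ) (z : ℂ) (hz : z ∈ U) : ‖c n * e ((n : ℂ) * z)‖ ≤
      ‖c n * e ((n : ℂ) * τ)‖ * Real.exp (2 * Real.pi * (w.im + 1) * |(n₀ : ℝ)|) := by
    by_cases hn : n < n₀
    · simp [hn₀ n hn]
    rw [norm_mul, norm_mul, mul_assoc]
    exact mul_le_mul_of_nonneg_left (norm_e_ratCast_mul_le (z := ⟨z, hpos hz⟩) (not_lt.1 hn)
      (hτ.trans_le hz.1.le) hz.2.le) (norm_nonneg _)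
  have hdiff : DifferentiableOn ℂ (fun z => ∑' n : ℚ, c n * e ((n : ℂ) * z)) U :=
    Complex.differentiableOn_tsum_of_summable_norm
      ((hg.hasSum τ).summable.norm.mul_right _) (fun n => by simp only [e]; fun_prop) hU hbound
  refine ((hdiff.differentiableAt (hU.mem_nhds hwU)).congr_of_eventuallyEq ?_
    ).differentiableWithinAt
  filter_upwards [hU.mem_nhds hwU] with z hz
  rw [Function.comp_apply, ← (hg.hasSum _).tsum_eq,
    UpperHalfPlane.ofComplex_apply_of_im_pos (hpos hz)]

end HasQExpansion

lemma hasFourierExpansion_iff {V : Type*} [AddCommGroup V] [Module ℚ V]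
    {B : LinearMap.BilinForm ℚ V} {N : Submodule ℤ V} [Finite (Disc B N)]
    {f : ℍ → (Disc B N →₀ ℂ)} {c : Disc B N → ℚ → ℂ} :
    (HasFourierExpansion B N f c ∧ ∀ a n, c a n ∈ S) ↔
      ∀ a, HasQExpansion S (B (rep a) (rep a) / 2) (fun τ => f τ a) (c a) := by
  refine ⟨fun ⟨hf, hc⟩ a => ⟨hc a, hf.support a, hf.bddBelow.imp fun _ h => h a, hf.hasSum a⟩,
    fun h => ⟨⟨fun a => (h a).support, ?_, fun a => (h a).hasSum⟩, fun a => (h a).coeff_mem⟩⟩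
  choose n hn using fun a => (h a).bddBelow
  obtain ⟨n₀, hn₀⟩ := (Set.finite_range n).bddBelow
  exact ⟨n₀, fun a m hm => hn a m (hm.trans_le (hn₀ ⟨a, rfl⟩))⟩

end QExpansion

namespace EvenLattice

variable {V : Type*} [AddCommGroup V] [Module ℚ V] {L : EvenLattice V} {S : Subring ℂ}

variable (L S) in
/-- The group of those `f ∈ M^!(L)` all of whose Fourier coefficients lie in the subring `S ⊆ ℂ`;
it is `M^!(L)` for `S = ℂ` and `M^!(L)'_ℤ` for `S = ℤ`. -/
def formsOver : AddSubgroup (ℍ → (L.A →₀ ℂ)) where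
  carrier := {f | f ∈ L.forms ∧
    ∃ c, HasFourierExpansion L.form L.lat f c ∧ ∀ a n, c a n ∈ S}
  zero_mem' := ⟨zero_mem _, 0, hasFourierExpansion_iff.2 fun _ => .zero⟩
  add_mem' := fun ⟨hf, c, hc⟩ ⟨hg, d, hd⟩ => ⟨add_mem hf hg, c + d, hasFourierExpansion_iff.2
    fun a => (hasFourierExpansion_iff.1 hc a).add (hasFourierExpansion_iff.1 hd a)⟩
  neg_mem' := fun ⟨hf, c, hc⟩ => ⟨neg_mem hf, -c, hasFourierExpansion_iff.2
    fun a => (hasFourierExpansion_iff.1 hc a).neg⟩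

lemma formsOver_top {f : ℍ → (L.A →₀ ℂ)} : f ∈ L.formsOver ⊤ ↔ f ∈ L.forms :=
  ⟨And.left, fun hf => ⟨hf, hf.meromorphic.imp fun _ hc => ⟨hc, fun _ _ => Subring.mem_top _⟩⟩⟩

lemma integralForms_eq_formsOver : L.integralForms = L.formsOver (Int.castRingHom ℂ).range := by
  ext f
  refine and_congr_right fun _ => ⟨fun ⟨c, hc⟩ => ⟨_, hc, fun a n => ⟨c a n, rfl⟩⟩, ?_⟩
  rintro ⟨c, hc, hcS⟩
  choose d hd using hcS
  obtain rfl : (fun a n => (d a n : ℂ)) = c := funext₂ hd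
  exact ⟨d, hc⟩

variable [FiniteDimensional ℚ V] {I : Submodule ℤ V} (hI : IQ I ≤ L.perp I)
include hI

lemma exists_hasQExpansion_thetaComponent (hpos : (-L.formK I).toQuadraticMap.PosDef)
    (S : Subring ℂ) (a : L.A) :
    ∃ c, HasQExpansion S (-(L.form (rep a) (rep a) / 2)) (L.thetaComponent I a) c := by
  let b (z : (-L.formK I).dualSubmodule (L.K I)) : ℂ :=
    (L.thetaCoset I a).indicator 1 (z : L.KQ I)
  have hb {z : (-L.formK I).dualSubmodule (L.K I)} (hz : b z ≠ 0) :
      (z : L.KQ I) ∈ L.thetaCoset I a := Set.mem_of_indicator_ne_zero hz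
  have hterm (τ : ℍ) (z : (-L.formK I).dualSubmodule (L.K I)) :
      (L.thetaCoset I a).indicator (fun z => e ((L.halfNorm I z : ℂ) * τ)) z =
        b z * e ((L.halfNorm I z : ℂ) * τ) := by
    by_cases hz : (z : L.KQ I) ∈ L.thetaCoset I a <;> simp [b, hz]
  have hsum (τ : ℍ) : HasSum (fun z => b z * e ((L.halfNorm I z : ℂ) * τ))
      (L.thetaComponent I a τ) := by
    simp_rw [thetaComponent_eq_tsum hI, ← hterm]
    exact (summable_norm_indicator_thetaCoset hpos a τ).of_norm.hasSum
  refine exists_hasQExpansion_of_hasSum (fun z => ?_) (fun z hz => exists_halfNorm_eq hI (hb hz))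
    (fun z _ => halfNorm_nonneg hpos _) (fun n => ?_) hsum
  · by_cases hz : (z : L.KQ I) ∈ L.thetaCoset I a <;> simp [b, hz, one_mem, zero_mem]
  · have hzero := (hsum UpperHalfPlane.I).summable.tendsto_cofinite_zero.eventually_ne
      (e_ne_zero ((n : ℂ) * (UpperHalfPlane.I : ℍ))).symm
    refine (Filter.eventually_cofinite.1 hzero).subset ?_
    rintro z ⟨rfl, hz⟩
    simp [b, hb hz]

variable (hrank : finrank ℚ (IQ I) = L.sigPos)
include hrank

lemma exists_hasQExpansion_xi {f : ℍ → (L.A →₀ ℂ)} {c : L.A → ℚ → ℂ}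
    (hf : ∀ a, HasQExpansion S (L.form (rep a) (rep a) / 2) (fun τ => f τ a) (c a)) :
    ∃ d, HasQExpansion S 0 (L.xi I f) d := by
  cases nonempty_fintype L.A
  have hterm (a : L.A) : ∃ d, HasQExpansion S 0
      ((fun τ => f τ a) * L.thetaComponent I a) d := by
    obtain ⟨t, ht⟩ := exists_hasQExpansion_thetaComponent hI (posDef_neg_formK hI hrank) S a
    simpa using (hf a).exists_mul ht
  choose d hd using hterm
  refine ⟨∑ a, d a, ?_⟩
  convert HasQExpansion.sum Finset.univ fun a _ => hd a
  ext τ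
  simp [xi_eq_sum]

lemma exists_hasQExpansion_thetaMul {f₁ f₂ : ℍ → (L.A →₀ ℂ)} {c₁ c₂ : L.A → ℚ → ℂ}
    (h₁ : ∀ a, HasQExpansion S (L.form (rep a) (rep a) / 2) (fun τ => f₁ τ a) (c₁ a))
    (h₂ : ∀ a, HasQExpansion S (L.form (rep a) (rep a) / 2) (fun τ => f₂ τ a) (c₂ a)) :
    ∃ c : L.A → ℚ → ℂ, ∀ a, HasQExpansion S (L.form (rep a) (rep a) / 2)
      (fun τ => L.thetaMul I f₁ f₂ τ a) (c a) := by
  obtain ⟨d, hd⟩ := exists_hasQExpansion_xi hI hrank h₁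
  choose c hc using fun a => hd.exists_mul (h₂ a)
  exact ⟨c, fun a => zero_add (L.form (rep a) (rep a) / 2) ▸ hc a⟩

lemma thetaMul_mem_formsOver {f₁ f₂ : ℍ → (L.A →₀ ℂ)} (h₁ : f₁ ∈ L.formsOver S)
    (h₂ : f₂ ∈ L.formsOver S) : L.thetaMul I f₁ f₂ ∈ L.formsOver S := by
  obtain ⟨hf₁, c₁, hc₁⟩ := h₁
  obtain ⟨hf₂, c₂, hc₂⟩ := h₂
  obtain ⟨c, hc⟩ := exists_hasQExpansion_thetaMul hI hrank
    (hasFourierExpansion_iff.1 hc₁) (hasFourierExpansion_iff.1 hc₂)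
  have hfourier := hasFourierExpansion_iff.2 hc
  refine ⟨⟨fun a => (hc a).mdifferentiable, fun g ρg hg τ => ?_, c, hfourier.1⟩, c, hfourier⟩
  have hxi := xi_smul_of_mem_weilGraph hI hf₁ hrank hg τ
  change L.xi I f₁ (g.mat • τ) • f₂ (g.mat • τ) = _ • ρg (L.xi I f₁ τ • f₂ τ)
  rw [hxi, hf₂.modular g ρg hg, map_smul, smul_comm]

lemma thetaMul_mem_forms {f₁ f₂ : ℍ → (L.A →₀ ℂ)} (h₁ : f₁ ∈ L.forms) (h₂ : f₂ ∈ L.forms) :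
    L.thetaMul I f₁ f₂ ∈ L.forms :=
  formsOver_top.1 (thetaMul_mem_formsOver hI hrank (formsOver_top.2 h₁) (formsOver_top.2 h₂))

end EvenLattice

end

end ThetaProduct

theorem mainTheorem9_general {V : Type*} [AddCommGroup V] [Module ℚ V] [FiniteDimensional ℚ V]
    (L : EvenLattice V) (S : Subring ℂ) (I : Submodule ℤ V)
    (hI : ∀ x ∈ I, ∀ y ∈ I, L.form x y = 0)
    (hrank : Module.finrank ℚ (EvenLattice.IQ I) = L.sigPos) :
    (∀ f₁ f₂ : ℍ → (L.A →₀ ℂ), f₁ ∈ L.formsOver S → f₂ ∈ L.formsOver S →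
      L.thetaMul I f₁ f₂ ∈ L.formsOver S) ∧
    ∃ M : NonUnitalSubring (L.ThetaAlgebra I), (∀ f, f ∈ M ↔ f ∈ L.forms) ∧
      ∃ R : NonUnitalSubring M, ∀ f : M, f ∈ R ↔ f.1 ∈ L.formsOver S := by
  have hIQ := L.IQ_le_perp hI
  let M : NonUnitalSubring (L.ThetaAlgebra I) :=
    { L.forms.toAddSubgroup with mul_mem' := EvenLattice.thetaMul_mem_forms hIQ hrank }
  let R : NonUnitalSubring M :=
    { carrier := {f | f.1 ∈ L.formsOver S}
      zero_mem' := zero_mem (L.formsOver S)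
      add_mem' := (L.formsOver S).add_mem
      neg_mem' := (L.formsOver S).neg_mem
      mul_mem' := EvenLattice.thetaMul_mem_formsOver hIQ hrank }
  exact ⟨fun _ _ => EvenLattice.thetaMul_mem_formsOver hIQ hrank, M, fun _ => Iff.rfl, R,
    fun _ => Iff.rfl⟩

/-- `M^!(L)'_ℤ` is closed under the `Θ`-product, and so it is a subring of the (non-unital)
ring `M^!(L)`. -/
theorem mainTheorem9 {V : Type*} [AddCommGroup V] [Module ℚ V] [FiniteDimensional ℚ V]
    (L : EvenLattice V) (p q : ℕ) (hp : L.sigPos = p) (hq : L.sigNeg = q) (hpq : p ≤ q)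
    (I : Submodule ℤ V) (hI : L.IsMaximalIsotropic I) :
    (∀ f₁ f₂ : ℍ → (L.A →₀ ℂ), f₁ ∈ L.integralForms → f₂ ∈ L.integralForms →
      L.thetaMul I f₁ f₂ ∈ L.integralForms) ∧
    ∃ M : NonUnitalSubring (L.ThetaAlgebra I), (∀ f, f ∈ M ↔ f ∈ L.forms) ∧
      ∃ R : NonUnitalSubring M, ∀ f : M, f ∈ R ↔ f.1 ∈ L.integralForms := by
  rw [EvenLattice.integralForms_eq_formsOver]
  exact mainTheorem9_general L _ I hI.isotropic hI.finrank_IQ
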